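/- All graphs are finite, simple and undirected, and paths are chordless. Let $l \ge 0$ and $k \ge 4$ be integers. A graph $G$ is an $(l,k)$-\emph{ttf-layered-wheel} if $V(G)$ is partitioned into (the vertex sets of) $l+1$ induced paths $P_0, P_1, \dots, P_l$, called layers, such that the following holds. For a vertex $u$ of $P_i$, an \emph{ancestor} of $u$ is a neighbor of $u$ in $V(P_0)\cup\dots\cup V(P_{i-1})$, and the \emph{type} of $u$ is the number of its ancestors. 1. $P_0$ consists of a single vertex. 2. For each $0 \le i < l$, the path $P_{i+1}$ contains pairwise disjoint subpaths $\mathrm{Box}_u$, one for each vertex $u$ of $P_i$, which appear along $P_{i+1}$ in the same order as the vertices $u$ appear along $P_i$; $P_{i+1}$ starts with the first vertex of the first box and ends with the last vertex of the last box. (Every vertex turns out to have type $0$ or $1$.) - If $u$ has type $0$, then $\mathrm{Box}_u = u_1 \dots u_2 \dots u_3$, where $u_1,u_2,u_3$ are distinct and each has $u$ as its only ancestor, and all other vertices of $\mathrm{Box}_u$ have type $0$. - If $u$ has type $1$ and $v$ is its unique ancestor, then $\mathrm{Box}_u = u_1 \dots u_2 \dots u_3 \dots v_1 \dots v_2 \dots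 v_3 \dots u_4 \dots u_5 \dots u_6$, where these nine vertices are distinct, each $u_r$ has $u$ as its only ancestor, each $v_r$ has $v$ as its only ancestor, and all other vertices of $\mathrm{Box}_u$ have type $0$. - The vertices of $P_{i+1}$ that are in none of the boxes have type $0$. 3. For each $0 \le i < l$, if $w, w'$ are distinct vertices of type $1$ in $P_{i+1}$ such that no internal vertex of the subpath $wP_{i+1}w'$ has type $1$, then $wP_{i+1}w'$ has length at least $k-2$. A \emph{theta} is a graph made of three internally vertex-disjoint chordless paths of length at least two with the same two distinct ends $a$ and $b$, with no edges other than those of the three paths. A graph is \emph{theta-free} if none of its induced subgraphs is a theta. The \emph{girth} of a graph is the length of its shortest cycle ($\infty$ if there is none). **Theorem.** For all integers $l \ge 0$ and $k \ge 4$, every $(l,k)$-ttf-layered-wheel is theta-free and has girth at least $k$; in particular, it is triangle-free. -/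

import Mathlib

/-- A walk is a chordless path: its vertices are distinct, and two of its vertices are adjacent
only when they are consecutive on it. -/
def SimpleGraph.Walk.IsChordlessPath {V : Type*} {G : SimpleGraph V} {a b : V}
    (p : G.Walk a b) : Prop :=
  p.IsPath ∧ ∀ x ∈ p.support, ∀ y ∈ p.support, G.Adj x y → s(x, y) ∈ p.edges

/-- A graph is a theta if it is made of three internally vertex-disjoint chordless paths of
length at least two with common ends `a` and `b`, without any edge other than those of the
three paths. -/
def SimpleGraph.IsTheta {V : Type*} (H : SimpleGraph V) : Prop :=
  ∃ (a b : V) (p : Fin 3 → H.Walk a b),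
    a ≠ b ∧
    (∀ r, (p r).IsChordlessPath ∧ 2 ≤ (p r).length) ∧
    (∀ r r', r ≠ r' → ∀ x, x ∈ (p r).support → x ∈ (p r').support → x = a ∨ x = b) ∧
    (∀ x, ∃ r, x ∈ (p r).support) ∧
    (∀ x y, H.Adj x y → ∃ r, s(x, y) ∈ (p r).edges)

/-- A graph is theta-free if none of its induced subgraphs is a theta. -/
def SimpleGraph.ThetaFree {V : Type*} (G : SimpleGraph V) : Prop :=
  ∀ S : Set V, ¬ (G.induce S).IsTheta

/-- A listing of vertices in layers: the `i`-th layer `P_i` consists of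
`vert i 0, vert i 1, …, vert i (len i - 1)`, in this order. -/
structure LayerListing (V : Type*) where
  len : ℕ → ℕ
  vert : ℕ → ℕ → V

namespace LayerListing

variable {V : Type*}

/-- The vertex set of the layer `P_i`. -/
def layer (L : LayerListing V) (i : ℕ) : Set V :=
  {v | ∃ j < L.len i, v = L.vert i j}

/-- The ancestors of `u = vert i j`: its neighbors in `P_0 ∪ ⋯ ∪ P_{i-1}`. -/
def ancestors (G : SimpleGraph V) (L : LayerListing V) (i j : ℕ) : Set V :=
  {w | G.Adj (L.vert i j) w ∧ ∃ i' < i, w ∈ L.layer i'}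

/-- The type of `u = vert i j`: the number of its ancestors. -/
noncomputable def vertexType (G : SimpleGraph V) (L : LayerListing V) (i j : ℕ) : ℕ∞ :=
  (ancestors G L i j).encard

end LayerListing

open LayerListing in
/-- The layers `P_0, …, P_l` listed by `L` exhibit `G` as an `(l, k)`-ttf-layered-wheel, where for
`i < l` and `j < L.len i` the box of `u = L.vert i j` is the subpath of `P_{i+1}` that
consists of the vertices with positions `lo i j, …, hi i j`. -/
structure IsTTFLayering {V : Type*} (G : SimpleGraph V) (l k : ℕ) (L : LayerListing V)
    (lo hi : ℕ → ℕ → ℕ) : Prop where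
  /-- Every vertex lies in a layer. -/
  cover : ∀ v, ∃ i ≤ l, v ∈ L.layer i
  /-- The layers are pairwise disjoint, and no vertex is repeated in a layer. -/
  inj : ∀ i ≤ l, ∀ i' ≤ l, ∀ j < L.len i, ∀ j' < L.len i',
    L.vert i j = L.vert i' j' → i = i' ∧ j = j'
  /-- Every layer induces a path, with the vertices in the listed order. -/
  path : ∀ i ≤ l, ∀ j < L.len i, ∀ j' < L.len i,
    G.Adj (L.vert i j) (L.vert i j') ↔ j' = j + 1 ∨ j = j' + 1
  /-- `P_0` is a single vertex. -/
  len_zero : L.len 0 = 1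
  /-- Boxes are subpaths. -/
  lo_le_hi : ∀ i < l, ∀ j < L.len i, lo i j ≤ hi i j
  /-- `P_{i+1}` starts with the first vertex of the first box. -/
  lo_first : ∀ i < l, lo i 0 = 0
  /-- `P_{i+1}` goes through the boxes in the order of the vertices of `P_i`; the boxes are
  disjoint. -/
  hi_lt_lo : ∀ i < l, ∀ j, j + 1 < L.len i → hi i j < lo i (j + 1)
  /-- `P_{i+1}` ends with the last vertex of the last box. -/
  hi_last : ∀ i < l, ∀ j, j + 1 = L.len i → hi i j + 1 = L.len (i + 1)
  /-- The box of a vertex `u` of type 0 is `u₁ … u₂ … u₃`, where `u₁, u₂, u₃` (at the positions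
  given by `q`) have `u` as their only ancestor and the other vertices have no ancestor. -/
  box_of_type_zero : ∀ i < l, ∀ j < L.len i, vertexType G L i j = 0 →
    ∃ q : Fin 3 → ℕ, StrictMono q ∧ q 0 = lo i j ∧ q 2 = hi i j ∧
      ∀ x, lo i j ≤ x → x ≤ hi i j → ∀ w,
        w ∈ ancestors G L (i + 1) x ↔ w = L.vert i j ∧ ∃ r, x = q r
  /-- The box of a vertex `u` of type 1 with ancestor `v` is
  `u₁ … u₂ … u₃ … v₁ … v₂ … v₃ … u₄ … u₅ … u₆`, where each `u_r` has `u` as its only ancestor,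
  each `v_r` has `v` as its only ancestor and the other vertices have no ancestor. -/
  box_of_type_one : ∀ i < l, ∀ j < L.len i, vertexType G L i j = 1 →
    ∀ v ∈ ancestors G L i j,
    ∃ q : Fin 9 → ℕ, StrictMono q ∧ q 0 = lo i j ∧ q 8 = hi i j ∧
      ∀ x, lo i j ≤ x → x ≤ hi i j → ∀ w,
        w ∈ ancestors G L (i + 1) x ↔
          (w = L.vert i j ∧ ∃ r ∈ ({0, 1, 2, 6, 7, 8} : Set (Fin 9)), x = q r) ∨
          (w = v ∧ ∃ r ∈ ({3, 4, 5} : Set (Fin 9)), x = q r)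
  /-- The vertices of `P_{i+1}` that are in none of the boxes have type 0. -/
  type_outside_boxes : ∀ i < l, ∀ x < L.len (i + 1),
    (∀ j < L.len i, ¬ (lo i j ≤ x ∧ x ≤ hi i j)) → vertexType G L (i + 1) x = 0
  /-- The subpath of `P_{i+1}` between two consecutive vertices of type 1 has length at least
  `k - 2`. -/
  spacing : ∀ i < l, ∀ x y, x < y → y < L.len (i + 1) →
    vertexType G L (i + 1) x = 1 → vertexType G L (i + 1) y = 1 →
    (∀ z, x < z → z < y → vertexType G L (i + 1) z ≠ 1) → k - 2 ≤ y - x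

/-- `G` is an `(l, k)`-ttf-layered-wheel. -/
def IsTTFLayeredWheel {V : Type*} (G : SimpleGraph V) (l k : ℕ) : Prop :=
  ∃ (L : LayerListing V) (lo hi : ℕ → ℕ → ℕ), IsTTFLayering G l k L lo hi

/-! Girth: take a finite nonempty set of minimum degree at least two, the highest layer that it
meets, and the first stretch of that layer inside it. Each end of the stretch needs an ancestor in
the set. A vertex has at most one ancestor, so the ends differ, and the spacing condition gives the
stretch at least `k - 1` vertices; an ancestor is one more (`le_ncard`).

Theta-freeness: a theta in the layers up to `P_{i+1}` is converted into one in the layers up to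
`P_i`, and the descent ends in the single vertex of `P_0` (`not_thetaFrame`). The induction runs on
a weaker object, `ThetaFrame`, which records only degrees and a coloring of the three paths. It
tolerates stray disjoint cycles, so the conversion can be checked locally; `exists_tight` discards
these cycles before each step.

In a tight frame every cycle contains both branch vertices (`no_cycle`). A stretch of the top layer
between consecutive neighbors of a vertex `u` of the frame closes a cycle with `u`, so its ends are
the branch vertices (`branch_of_run`). As neighbors come in triples, this is impossible (`triple`).
Hence no branch vertex lies in the top layer (`not_branch`), and all that matters there is which
gaps between boxes the frame fills and where it attaches to older vertices (`exists_ports`,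
`exists_gapFrame`).

To push the frame down, a filled gap between the boxes of `w j` and `w (j + 1)` is replaced by the
edge joining these vertices, and they are inserted if absent. Let `w j` be inserted. If its ancestor
is not in the frame, the frame crossed the whole box and now passes through `w j`. If the frame has
an ancestor `v` and fills one gap at `w j`, it turns from `w j` to `v`. If it fills both gaps, it
met `v` twice: an ordinary `v` is bypassed and dropped, while a branch vertex `v` hands its role to
`w j` and stays as a vertex of degree two. Adjacent vertices of a layer never both have ancestors,
which excludes unwanted edges. -/

namespace SimpleGraph

/-! ### Theta frames and tightness. -/

variable {V : Type*} {G : SimpleGraph V} {S : Set V} {a b : V} {c : V → Fin 3}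

/-- The neighbors of `x` in the set `S`. -/
def nbrsIn (G : SimpleGraph V) (S : Set V) (x : V) : Set V := {y | y ∈ S ∧ G.Adj x y}

/-- A coloring witnessing that `G` induces on `S` a theta with branch vertices `a` and `b`,
up to disjoint cycles: the colors tell the three paths apart. -/
structure ThetaFrame (G : SimpleGraph V) (S : Set V) (a b : V) (c : V → Fin 3) : Prop where
  fin : S.Finite
  left_mem : a ∈ S
  right_mem : b ∈ S
  ne : a ≠ b
  not_adj : ¬ G.Adj a b
  deg : ∀ x ∈ S, x ≠ a → x ≠ b → (nbrsIn G S x).encard = 2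
  col : ∀ x ∈ S, x ≠ a → x ≠ b → ∀ y ∈ nbrsIn G S x, y ≠ a → y ≠ b → c y = c x
  bij_left : Set.BijOn c (nbrsIn G S a) Set.univ
  bij_right : Set.BijOn c (nbrsIn G S b) Set.univ

namespace ThetaFrame

theorem bij (h : ThetaFrame G S a b c) {x : V} (hx : x = a ∨ x = b) :
    Set.BijOn c (nbrsIn G S x) Set.univ := by
  rcases hx with rfl | rfl
  exacts [h.bij_left, h.bij_right]

theorem not_adj_of_branch (h : ThetaFrame G S a b c) {x y : V} (hx : x = a ∨ x = b)
    (hy : y = a ∨ y = b) : ¬ G.Adj x y := by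
  rcases hx with rfl | rfl <;> rcases hy with rfl | rfl
  exacts [G.loopless.irrefl _, h.not_adj, fun e => h.not_adj e.symm, G.loopless.irrefl _]

theorem branch_encard (h : ThetaFrame G S a b c) {x : V} (hx : x = a ∨ x = b) :
    (nbrsIn G S x).encard = 3 := by
  rw [← (h.bij hx).injOn.encard_image, (h.bij hx).image_eq, Set.encard_univ]
  simp

theorem exists_ne_ne (h : ThetaFrame G S a b c) {x : V} (hx : x = a ∨ x = b) (y z : V) :
    ∃ t ∈ nbrsIn G S x, t ≠ y ∧ t ≠ z := by
  by_contra! hc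
  have hs : nbrsIn G S x ⊆ {y, z} := fun t ht => by
    by_cases e : t = y
    · exact Or.inl e
    · exact Or.inr (hc t ht e)
  have := (Set.encard_le_encard hs).trans (Set.encard_insert_le {z} y)
  rw [h.branch_encard hx, Set.encard_singleton] at this
  norm_num at this

theorem exists_ne (h : ThetaFrame G S a b c) {x : V} (hx : x ∈ S) (y : V) :
    ∃ t ∈ nbrsIn G S x, t ≠ y := by
  by_cases hb : x = a ∨ x = b
  · obtain ⟨t, ht, h1, -⟩ := h.exists_ne_ne hb y y
    exact ⟨t, ht, h1⟩
  · push Not at hb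
    have hd := h.deg x hx hb.1 hb.2
    by_contra! hc
    have hs : nbrsIn G S x ⊆ {y} := fun t ht => hc t ht
    have := Set.encard_le_encard hs
    rw [hd, Set.encard_singleton] at this
    norm_num at this

theorem eq_or_eq (h : ThetaFrame G S a b c) {x y z t : V} (hx : x ∈ S) (hb : ¬ (x = a ∨ x = b))
    (hy : y ∈ nbrsIn G S x) (hz : z ∈ nbrsIn G S x) (hyz : y ≠ z) (ht : t ∈ nbrsIn G S x) :
    t = y ∨ t = z := by
  push Not at hb
  have hd := h.deg x hx hb.1 hb.2
  have hs : ({y, z} : Set V) ⊆ nbrsIn G S x := by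
    rintro _ (rfl | rfl) <;> assumption
  have := (Set.toFinite {y, z}).eq_of_subset_of_encard_le hs (by rw [hd, Set.encard_pair hyz])
  rw [← this] at ht
  exact ht

theorem not_branch_of_adj (h : ThetaFrame G S a b c) {x y : V} (hx : x = a ∨ x = b)
    (e : G.Adj x y) : ¬ (y = a ∨ y = b) := fun hy => h.not_adj_of_branch hx hy e

theorem col_eq (h : ThetaFrame G S a b c) {x y : V} (hx : x ∈ S) (hy : y ∈ S)
    (hbx : ¬ (x = a ∨ x = b)) (hby : ¬ (y = a ∨ y = b)) (e : G.Adj x y) : c x = c y := by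
  push Not at hbx hby
  exact (h.col x hx hbx.1 hbx.2 y ⟨hy, e⟩ hby.1 hby.2).symm

/-- Removing a union of disjoint cycles. -/
theorem diff (h : ThetaFrame G S a b c) {T : Set V} (ha : a ∉ T) (hb : b ∉ T)
    (hT : ∀ x ∈ T, nbrsIn G S x ⊆ T) : ThetaFrame G (S \ T) a b c := by
  have key : ∀ x ∈ S, x ∉ T → nbrsIn G (S \ T) x = nbrsIn G S x := by
    intro x hx hxT
    ext y
    refine ⟨fun hy => ⟨hy.1.1, hy.2⟩, fun hy => ⟨⟨hy.1, fun hyT => hxT ?_⟩, hy.2⟩⟩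
    exact hT y hyT ⟨hx, hy.2.symm⟩
  refine ⟨h.fin.sdiff, ⟨h.left_mem, ha⟩, ⟨h.right_mem, hb⟩, h.ne, h.not_adj, ?_, ?_, ?_, ?_⟩
  · rintro x ⟨hx, hxT⟩ h1 h2
    rw [key x hx hxT]
    exact h.deg x hx h1 h2
  · rintro x ⟨hx, hxT⟩ h1 h2 y hy
    rw [key x hx hxT] at hy
    exact h.col x hx h1 h2 y hy
  · rw [key a h.left_mem ha]
    exact h.bij_left
  · rw [key b h.right_mem hb]
    exact h.bij_right

/-- No cycle avoids the branch vertices. -/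
def Tight (G : SimpleGraph V) (S : Set V) (a b : V) : Prop :=
  ∀ T ⊆ S, T.Nonempty → a ∉ T → b ∉ T → ∃ x ∈ T, ¬ nbrsIn G S x ⊆ T

/-- A set violating tightness is closed under taking neighbors in `S` and avoids `a` and `b`.
Deleting it leaves a smaller frame, so induction on the cardinality applies. -/
theorem exists_tight (h : ThetaFrame G S a b c) :
    ∃ S' ⊆ S, ThetaFrame G S' a b c ∧ Tight G S' a b := by
  obtain ⟨n, hn⟩ : ∃ n, S.ncard = n := ⟨_, rfl⟩
  induction n using Nat.strong_induction_on generalizing S with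
  | _ n ih =>
    by_cases ht : Tight G S a b
    · exact ⟨S, subset_rfl, h, ht⟩
    · unfold Tight at ht
      push Not at ht
      obtain ⟨T, hTS, hne, ha, hb, hT⟩ := ht
      obtain ⟨S', h1, h2⟩ := ih _ (by
        rw [← hn]
        obtain ⟨t, ht⟩ := hne
        exact Set.ncard_lt_ncard
          (Set.ssubset_iff_of_subset Set.sdiff_subset |>.2 ⟨t, hTS ht, fun h => h.2 ht⟩)
          h.fin) (h.diff ha hb hT) rfl
      exact ⟨S', h1.trans Set.sdiff_subset, h2⟩

/-- No cycle goes through at most one branch vertex. -/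
theorem no_cycle (h : ThetaFrame G S a b c) (ht : Tight G S a b) {T : Set V} {z y y' : V}
    (hT : T ⊆ S) (hb : ∀ x ∈ T, ¬ (x = a ∨ x = b)) (hc : ∀ x ∈ T, ∀ x' ∈ T, c x = c x')
    (hn : ∀ x ∈ T, ∀ t ∈ nbrsIn G S x, t ∈ T ∨ t = z) (hz : z ∈ S) (hy : y ∈ T) (hy' : y' ∈ T)
    (hyy : y ≠ y') (hzy : G.Adj z y) (hzy' : G.Adj z y') : False := by
  -- A branch vertex `z` has neighbors of distinct colors, but `T` is monochromatic. Any other `z`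
  -- has degree two with both neighbors in `T`, so `insert z T` is closed, against tightness.
  by_cases hbz : z = a ∨ z = b
  · exact hyy ((h.bij hbz).injOn ⟨hT hy, hzy⟩ ⟨hT hy', hzy'⟩ (hc y hy y' hy'))
  · obtain ⟨x, hx, hnx⟩ := ht (insert z T) (Set.insert_subset hz hT) ⟨z, Or.inl rfl⟩
      (by
        rintro (e | e)
        · exact hbz (Or.inl e.symm)
        · exact hb _ e (Or.inl rfl))
      (by
        rintro (e | e)
        · exact hbz (Or.inr e.symm)
        · exact hb _ e (Or.inr rfl))
    apply hnx
    intro t htx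
    rcases hx with rfl | hx
    · rcases h.eq_or_eq hz hbz ⟨hT hy, hzy⟩ ⟨hT hy', hzy'⟩ hyy htx with rfl | rfl
      exacts [Or.inr hy, Or.inr hy']
    · exact (hn x hx t htx).symm

end ThetaFrame

/-! ### From thetas to theta frames. -/

section OfTheta

variable {W : Type*} {H : SimpleGraph W}

theorem Walk.IsPath.mem_edges_getVert_iff {u v : W} {p : H.Walk u v} (hp : p.IsPath) {i : ℕ}
    (hi : i ≤ p.length) {y : W} :
    s(p.getVert i, y) ∈ p.edges ↔
      (i < p.length ∧ y = p.getVert (i + 1)) ∨ (1 ≤ i ∧ y = p.getVert (i - 1)) := by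
  have hinj := hp.getVert_injOn
  rw [Walk.mk_mem_edges_iff_exists]
  constructor
  · rintro ⟨n, hn, e⟩
    rw [Sym2.eq_iff] at e
    rcases e with ⟨e1, e2⟩ | ⟨e1, e2⟩
    · obtain rfl : n = i := hinj (show n ≤ _ by omega) hi e1
      exact Or.inl ⟨hn, e2.symm⟩
    · obtain rfl : n + 1 = i := hinj (show n + 1 ≤ _ by omega) hi e2
      exact Or.inr ⟨by omega, e1.symm⟩
  · rintro (⟨h, rfl⟩ | ⟨h, rfl⟩)
    · exact ⟨i, h, rfl⟩
    · refine ⟨i - 1, by omega, ?_⟩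
      rw [Nat.sub_add_cancel h, Sym2.eq_swap]

theorem IsTheta.exists_thetaFrame [Finite W] (h : H.IsTheta) :
    ∃ a b c, ThetaFrame H Set.univ a b c := by
  obtain ⟨a, b, p, hab, hp, hd, hc, he⟩ := h
  -- The color of an inner vertex is the index of its path. At `a` and `b` the choice is arbitrary,
  -- and no condition on frames looks at these two colors.
  choose c hc using hc
  have hpath : ∀ r, (p r).IsPath := fun r => (hp r).1.1
  have hlen : ∀ r, 2 ≤ (p r).length := fun r => (hp r).2
  have huniq : ∀ x r, x ≠ a → x ≠ b → x ∈ (p r).support → c x = r := by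
    intro x r h1 h2 hx
    by_contra hne
    rcases hd _ _ hne x (hc x) hx with e | e
    exacts [h1 e, h2 e]
  have hedge : ∀ x y, x ≠ a → x ≠ b → (H.Adj x y ↔ s(x, y) ∈ (p (c x)).edges) := by
    intro x y h1 h2
    refine ⟨fun e => ?_, fun e => (p (c x)).adj_of_mem_edges e⟩
    obtain ⟨r, hr⟩ := he x y e
    rwa [huniq x r h1 h2 ((p r).fst_mem_support_of_mem_edges hr)]
  have hinner : ∀ r i, 0 < i → i < (p r).length →
      (p r).getVert i ≠ a ∧ (p r).getVert i ≠ b := by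
    intro r i h0 hi
    constructor <;> intro e
    · have := (hpath r).getVert_injOn (show i ≤ _ by omega) (show 0 ≤ _ by omega)
        (e.trans (p r).getVert_zero.symm)
      omega
    · have := (hpath r).getVert_injOn (show i ≤ _ by omega) (show (p r).length ≤ _ by omega)
        (e.trans (p r).getVert_length.symm)
      omega
  have hnb : ∀ x, x ≠ a → x ≠ b → ∃ i, 0 < i ∧ i < (p (c x)).length ∧
      (p (c x)).getVert i = x := by
    intro x h1 h2
    obtain ⟨i, e, hi⟩ := Walk.mem_support_iff_exists_getVert.1 (hc x)
    refine ⟨i, Nat.pos_of_ne_zero ?_, lt_of_le_of_ne hi ?_, e⟩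
    · rintro rfl
      exact h1 (e.symm.trans (p (c x)).getVert_zero)
    · rintro rfl
      exact h2 (e.symm.trans (p (c x)).getVert_length)
  have hca : ∀ r, c ((p r).getVert 1) = r := fun r =>
    huniq _ r (hinner r 1 one_pos (hlen r)).1 (hinner r 1 one_pos (hlen r)).2
      ((p r).getVert_mem_support 1)
  have hcb : ∀ r, c ((p r).getVert ((p r).length - 1)) = r := fun r =>
    have h2 := hlen r
    have h3 := hinner r ((p r).length - 1) (by omega) (by omega)
    huniq _ r h3.1 h3.2 ((p r).getVert_mem_support _)
  have hna : ∀ y, H.Adj a y ↔ ∃ r, y = (p r).getVert 1 := by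
    intro y
    have key : ∀ r, s(a, y) ∈ (p r).edges ↔ y = (p r).getVert 1 := by
      intro r
      have h2 := hlen r
      have := (hpath r).mem_edges_getVert_iff (i := 0) (by omega) (y := y)
      rw [Walk.getVert_zero] at this
      rw [this]
      constructor
      · rintro (h | h)
        · exact h.2
        · omega
      · exact fun h => Or.inl ⟨by omega, h⟩
    constructor
    · intro e
      obtain ⟨r, hr⟩ := he a y e
      exact ⟨r, (key r).1 hr⟩
    · rintro ⟨r, hr⟩
      exact (p r).adj_of_mem_edges ((key r).2 hr)
  have hnb' : ∀ y, H.Adj b y ↔ ∃ r, y = (p r).getVert ((p r).length - 1) := by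
    intro y
    have key : ∀ r, s(b, y) ∈ (p r).edges ↔ y = (p r).getVert ((p r).length - 1) := by
      intro r
      have h2 := hlen r
      have := (hpath r).mem_edges_getVert_iff (i := (p r).length) le_rfl (y := y)
      rw [Walk.getVert_length] at this
      rw [this]
      constructor
      · rintro (h | h)
        · omega
        · exact h.2
      · exact fun h => Or.inr ⟨by omega, h⟩
    constructor
    · intro e
      obtain ⟨r, hr⟩ := he b y e
      exact ⟨r, (key r).1 hr⟩
    · rintro ⟨r, hr⟩
      exact (p r).adj_of_mem_edges ((key r).2 hr)
  refine ⟨a, b, c, Set.finite_univ, trivial, trivial, hab, ?_, ?_, ?_, ?_, ?_⟩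
  · intro e
    obtain ⟨r, hr⟩ := (hna b).1 e
    exact (hinner r 1 one_pos (hlen r)).2 hr.symm
  · intro x _ h1 h2
    obtain ⟨i, h0, hi, e⟩ := hnb x h1 h2
    have : nbrsIn H Set.univ x = {(p (c x)).getVert (i + 1), (p (c x)).getVert (i - 1)} := by
      ext y
      have hm := (hpath (c x)).mem_edges_getVert_iff (i := i) hi.le (y := y)
      rw [e] at hm
      have : y ∈ nbrsIn H Set.univ x ↔ H.Adj x y := ⟨fun h => h.2, fun h => ⟨trivial, h⟩⟩
      rw [this, hedge x y h1 h2, hm]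
      constructor
      · rintro (h | h)
        exacts [Or.inl h.2, Or.inr h.2]
      · rintro (h | h)
        exacts [Or.inl ⟨hi, h⟩, Or.inr ⟨h0, h⟩]
    rw [this, Set.encard_pair]
    intro e
    have := (hpath (c x)).getVert_injOn (show i + 1 ≤ _ by omega) (show i - 1 ≤ _ by omega) e
    omega
  · intro x _ h1 h2 y hy h3 h4
    exact huniq y _ h3 h4 ((p (c x)).snd_mem_support_of_mem_edges ((hedge x y h1 h2).1 hy.2))
  · refine ⟨fun _ _ => trivial, ?_, fun r _ => ⟨_, ⟨trivial, (hna _).2 ⟨r, rfl⟩⟩, hca r⟩⟩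
    rintro y ⟨-, hy⟩ z ⟨-, hz⟩ hyz
    obtain ⟨r, rfl⟩ := (hna y).1 hy
    obtain ⟨r', rfl⟩ := (hna z).1 hz
    rw [hca, hca] at hyz
    rw [hyz]
  · refine ⟨fun _ _ => trivial, ?_, fun r _ => ⟨_, ⟨trivial, (hnb' _).2 ⟨r, rfl⟩⟩, hcb r⟩⟩
    rintro y ⟨-, hy⟩ z ⟨-, hz⟩ hyz
    obtain ⟨r, rfl⟩ := (hnb' y).1 hy
    obtain ⟨r', rfl⟩ := (hnb' z).1 hz
    rw [hcb, hcb] at hyz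
    rw [hyz]

theorem ThetaFrame.map {a b : W} {c : W → Fin 3} (h : ThetaFrame H Set.univ a b c)
    (f : H ↪g G) : ∃ c', ThetaFrame G (Set.range f) (f a) (f b) c' := by
  refine ⟨Function.extend f c 0, ?_⟩
  have key : ∀ x, nbrsIn G (Set.range f) (f x) = f '' nbrsIn H Set.univ x := by
    intro x
    ext y
    constructor
    · rintro ⟨⟨y, rfl⟩, e⟩
      exact ⟨y, ⟨trivial, f.map_adj_iff.1 e⟩, rfl⟩
    · rintro ⟨y, ⟨-, e⟩, rfl⟩
      exact ⟨⟨y, rfl⟩, f.map_adj_iff.2 e⟩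
  have hce : ∀ x, Function.extend f c 0 (f x) = c x := fun x => f.injective.extend_apply c 0 x
  have bij : ∀ x, Set.BijOn c (nbrsIn H Set.univ x) Set.univ →
      Set.BijOn (Function.extend f c 0) (nbrsIn G (Set.range f) (f x)) Set.univ := by
    intro x hx
    rw [key]
    refine ⟨fun _ _ => trivial, ?_, ?_⟩
    · rintro _ ⟨y, hy, rfl⟩ _ ⟨z, hz, rfl⟩ e
      rw [hce, hce] at e
      rw [hx.injOn hy hz e]
    · intro r _
      obtain ⟨y, hy, rfl⟩ := hx.surjOn (Set.mem_univ r)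
      exact ⟨f y, ⟨y, hy, rfl⟩, hce y⟩
  refine ⟨by simpa using h.fin.image f, ⟨a, rfl⟩, ⟨b, rfl⟩, f.injective.ne h.ne,
    fun e => h.not_adj (f.map_adj_iff.1 e), ?_, ?_, bij a h.bij_left, bij b h.bij_right⟩
  · rintro _ ⟨x, rfl⟩ h1 h2
    rw [key, f.injective.encard_image]
    exact h.deg x trivial (fun e => h1 (e ▸ rfl)) (fun e => h2 (e ▸ rfl))
  · rintro _ ⟨x, rfl⟩ h1 h2 y hy h3 h4
    rw [key] at hy
    obtain ⟨y, hy, rfl⟩ := hy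
    rw [hce, hce]
    exact h.col x trivial (fun e => h1 (e ▸ rfl)) (fun e => h2 (e ▸ rfl)) y hy
      (fun e => h3 (e ▸ rfl)) (fun e => h4 (e ▸ rfl))

end OfTheta

end SimpleGraph

/-! ### Two consecutive layers of a wheel. -/

/-- Two consecutive layers of a ttf-layered-wheel: `w 0, …, w (n - 1)` and then
`p 0, …, p (m - 1)`, where `low` is the union of the earlier layers and `old` also includes
the layer of `w`. -/
structure BoxStep {V : Type*} (G : SimpleGraph V) (low old : Set V) (n m : ℕ) (w p : ℕ → V)
    (lo hi : ℕ → ℕ) : Prop where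
  mem_old : ∀ u, u ∈ old ↔ u ∈ low ∨ ∃ j < n, u = w j
  w_inj : ∀ j < n, ∀ j' < n, w j = w j' → j = j'
  p_inj : ∀ x < m, ∀ x' < m, p x = p x' → x = x'
  w_not_low : ∀ j < n, w j ∉ low
  p_not_old : ∀ x < m, p x ∉ old
  w_adj : ∀ j < n, ∀ j' < n, G.Adj (w j) (w j') ↔ j' = j + 1 ∨ j = j' + 1
  p_adj : ∀ x < m, ∀ x' < m, G.Adj (p x) (p x') ↔ x' = x + 1 ∨ x = x' + 1
  low_unique : ∀ j < n, ∀ u ∈ low, ∀ v ∈ low, G.Adj (w j) u → G.Adj (w j) v → u = v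
  low_sep : ∀ j, j + 1 < n → ∀ u ∈ low, ∀ v ∈ low, G.Adj (w j) u → ¬ G.Adj (w (j + 1)) v
  n_pos : 0 < n
  lo_zero : lo 0 = 0
  lo_le_hi : ∀ j < n, lo j ≤ hi j
  hi_lt_lo : ∀ j, j + 1 < n → hi j < lo (j + 1)
  hi_last : hi (n - 1) + 1 = m
  box_zero : ∀ j < n, (∀ u ∈ low, ¬ G.Adj (w j) u) →
    ∃ y, lo j < y ∧ y < hi j ∧ ∀ x, lo j ≤ x → x ≤ hi j → ∀ u ∈ old,
      (G.Adj (p x) u ↔ u = w j ∧ (x = lo j ∨ x = y ∨ x = hi j))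
  box_one : ∀ j < n, ∀ v ∈ low, G.Adj (w j) v →
    ∃ y₁ y₂ y₃ y₄ y₅ y₆ y₇, lo j < y₁ ∧ y₁ < y₂ ∧ y₂ < y₃ ∧ y₃ < y₄ ∧ y₄ < y₅ ∧ y₅ < y₆ ∧
      y₆ < y₇ ∧ y₇ < hi j ∧ ∀ x, lo j ≤ x → x ≤ hi j → ∀ u ∈ old,
        (G.Adj (p x) u ↔
          (u = w j ∧ (x = lo j ∨ x = y₁ ∨ x = y₂ ∨ x = y₆ ∨ x = y₇ ∨ x = hi j)) ∨
          (u = v ∧ (x = y₃ ∨ x = y₄ ∨ x = y₅)))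
  outside : ∀ x < m, (∀ j < n, ¬ (lo j ≤ x ∧ x ≤ hi j)) → ∀ u ∈ old, ¬ G.Adj (p x) u

namespace LayerListing

/-- The union of the layers before `P_i`. -/
def below {V : Type*} (L : LayerListing V) (i : ℕ) : Set V := {v | ∃ i' < i, v ∈ L.layer i'}

end LayerListing

namespace IsTTFLayering

open LayerListing

variable {V : Type*} {G : SimpleGraph V} {l k : ℕ} {L : LayerListing V} {lo hi : ℕ → ℕ → ℕ}

theorem mem_ancestors {i j : ℕ} {u : V} :
    u ∈ ancestors G L i j ↔ G.Adj (L.vert i j) u ∧ u ∈ L.below i := Iff.rfl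

/-- The box axioms apply to a vertex only once its type is known to be 0 or 1, hence an induction on
the layers. In a box of a type 1 vertex, strict monotonicity of `q` keeps the positions attached to
`u` and to `v` apart. -/
theorem ancestors_subsingleton (h : IsTTFLayering G l k L lo hi) {i : ℕ} (hi' : i ≤ l) :
    ∀ j < L.len i, (ancestors G L i j).Subsingleton := by
  induction i with
  | zero =>
    rintro j - u ⟨-, i', h0, -⟩
    omega
  | succ i ih =>
    intro x hx
    by_cases hb : ∃ j < L.len i, lo i j ≤ x ∧ x ≤ hi i j
    · obtain ⟨j, hj, h1, h2⟩ := hb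
      rcases (ih (by omega) j hj).eq_empty_or_singleton with e | ⟨v, e⟩
      · obtain ⟨q, -, -, -, hq⟩ := h.box_of_type_zero i (by omega) j hj
          (by rw [vertexType, e, Set.encard_empty])
        intro u hu u' hu'
        rw [((hq x h1 h2 u).1 hu).1, ((hq x h1 h2 u').1 hu').1]
      · obtain ⟨q, hm, -, -, hq⟩ := h.box_of_type_one i (by omega) j hj
          (by rw [vertexType, e, Set.encard_singleton]) v (by rw [e]; rfl)
        intro u hu u' hu'
        have key : ∀ r ∈ ({0, 1, 2, 6, 7, 8} : Set (Fin 9)),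
            ∀ r' ∈ ({3, 4, 5} : Set (Fin 9)), q r ≠ q r' := by
          intro r hr r' hr' e
          rw [hm.injective e] at hr
          simp only [Set.mem_insert_iff, Set.mem_singleton_iff] at hr hr'
          omega
        rcases (hq x h1 h2 u).1 hu with ⟨e1, r, hr, er⟩ | ⟨e1, r, hr, er⟩ <;>
          rcases (hq x h1 h2 u').1 hu' with ⟨e1', r', hr', er'⟩ | ⟨e1', r', hr', er'⟩
        · rw [e1, e1']
        · exact (key r hr r' hr' (er.symm.trans er')).elim
        · exact (key r' hr' r hr (er'.symm.trans er)).elim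
        · rw [e1, e1']
    · push Not at hb
      have := h.type_outside_boxes i (by omega) x hx (by
        intro j hj h1
        exact absurd (hb j hj h1.1) (by omega))
      rw [vertexType, Set.encard_eq_zero] at this
      rw [this]
      exact Set.subsingleton_empty

theorem vertexType_eq_zero (j : ℕ) {i : ℕ} (h0 : ∀ u ∈ L.below i, ¬ G.Adj (L.vert i j) u) :
    vertexType G L i j = 0 := by
  rw [vertexType, Set.encard_eq_zero, Set.eq_empty_iff_forall_notMem]
  rintro u ⟨h1, h2⟩
  exact h0 u h2 h1

theorem vertexType_eq_one (h : IsTTFLayering G l k L lo hi) {i j : ℕ} (hi' : i ≤ l)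
    (hj : j < L.len i) {u : V} (hu : u ∈ L.below i) (e : G.Adj (L.vert i j) u) :
    vertexType G L i j = 1 := by
  rw [vertexType, Set.encard_eq_one]
  exact ⟨u, (h.ancestors_subsingleton hi' j hj).eq_singleton_of_mem ⟨e, hu⟩⟩

theorem len_pos (h : IsTTFLayering G l k L lo hi) {i : ℕ} (hi' : i ≤ l) : 0 < L.len i := by
  induction i with
  | zero => rw [h.len_zero]; exact one_pos
  | succ i ih =>
    have h0 := ih (by omega)
    have := h.hi_last i (by omega) (L.len i - 1) (by omega)
    omega

/-- The spacing axiom concerns consecutive type 1 vertices; it is applied to `x` and the first type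
1 vertex after it, which does not lie beyond `y`. -/
theorem le_sub (h : IsTTFLayering G l k L lo hi) {i x y : ℕ} (hil : i < l) (hxy : x < y)
    (hy : y < L.len (i + 1)) (tx : vertexType G L (i + 1) x = 1)
    (ty : vertexType G L (i + 1) y = 1) : k - 2 ≤ y - x := by
  classical
  have hex : ∃ z, x < z ∧ vertexType G L (i + 1) z = 1 := ⟨y, hxy, ty⟩
  have hle : Nat.find hex ≤ y := Nat.find_min' hex ⟨hxy, ty⟩
  have := h.spacing i hil x (Nat.find hex) (Nat.find_spec hex).1 (by omega) tx
    (Nat.find_spec hex).2 (fun z h1 h2 h3 => Nat.find_min hex h2 ⟨h1, h3⟩)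
  omega

theorem boxStep (h : IsTTFLayering G l k L lo hi) (hk : 4 ≤ k) {i : ℕ} (hil : i < l) :
    BoxStep G (L.below i) (L.below (i + 1)) (L.len i) (L.len (i + 1)) (L.vert i)
      (L.vert (i + 1)) (lo i) (hi i) where
  mem_old u := by
    constructor
    · rintro ⟨i', hi', hu⟩
      rcases Nat.lt_succ_iff_lt_or_eq.1 hi' with h1 | rfl
      exacts [Or.inl ⟨i', h1, hu⟩, Or.inr hu]
    · rintro (⟨i', hi', hu⟩ | hu)
      exacts [⟨i', by omega, hu⟩, ⟨i, by omega, hu⟩]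
  w_inj j hj j' hj' e := (h.inj i hil.le i hil.le j hj j' hj' e).2
  p_inj x hx x' hx' e := (h.inj (i + 1) hil (i + 1) hil x hx x' hx' e).2
  w_not_low := by
    rintro j hj ⟨i', hi', j', hj', e⟩
    have := (h.inj i hil.le i' (by omega) j hj j' hj' e).1
    omega
  p_not_old := by
    rintro j hj ⟨i', hi', j', hj', e⟩
    have := (h.inj (i + 1) hil i' (by omega) j hj j' hj' e).1
    omega
  w_adj := h.path i hil.le
  p_adj := h.path (i + 1) hil
  low_unique j hj u hu v hv e e' := h.ancestors_subsingleton hil.le j hj ⟨e, hu⟩ ⟨e', hv⟩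
  low_sep j hj u hu v hv e e' := by
    cases i with
    | zero =>
      rw [h.len_zero] at hj
      omega
    | succ i =>
      -- Here theta-freeness uses `4 ≤ k`: adjacent vertices of type 1 would have distance 1, less
      -- than `k - 2`.
      have := h.le_sub (by omega) (Nat.lt_succ_self j) hj
        (h.vertexType_eq_one hil.le (by omega) hu e) (h.vertexType_eq_one hil.le hj hv e')
      omega
  n_pos := h.len_pos hil.le
  lo_zero := h.lo_first i hil
  lo_le_hi := h.lo_le_hi i hil
  hi_lt_lo := h.hi_lt_lo i hil
  hi_last := h.hi_last i hil _ (Nat.sub_add_cancel (h.len_pos hil.le))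
  box_zero j hj h0 := by
    obtain ⟨q, hm, h1, h2, hq⟩ := h.box_of_type_zero i hil j hj (vertexType_eq_zero j h0)
    refine ⟨q 1, h1 ▸ hm (by decide), h2 ▸ hm (by decide), fun x hx hx' u hu => ?_⟩
    have := hq x hx hx' u
    rw [mem_ancestors, and_iff_left hu] at this
    rw [this, ← h1, ← h2, Fin.exists_fin_succ, Fin.exists_fin_two]
    rfl
  box_one j hj v hv e := by
    obtain ⟨q, hm, h1, h2, hq⟩ := h.box_of_type_one i hil j hj
      (h.vertexType_eq_one hil.le hj hv e) v ⟨e, hv⟩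
    refine ⟨q 1, q 2, q 3, q 4, q 5, q 6, q 7, h1 ▸ hm (by decide), hm (by decide),
      hm (by decide), hm (by decide), hm (by decide), hm (by decide), hm (by decide),
      h2 ▸ hm (by decide), fun x hx hx' u hu => ?_⟩
    have := hq x hx hx' u
    rw [mem_ancestors, and_iff_left hu] at this
    rw [this, ← h1, ← h2]
    simp
  outside x hx hb u hu e := by
    have := h.type_outside_boxes i hil x hx hb
    rw [vertexType, Set.encard_eq_zero] at this
    exact Set.eq_empty_iff_forall_notMem.1 this u ⟨e, hu⟩

/-! ### Girth. -/

/-- A finite set of vertices of minimum degree at least two has at least `k` elements. -/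
theorem le_ncard (h : IsTTFLayering G l k L lo hi) {C : Set V} (hC : C.Finite)
    (hne : C.Nonempty) (hd : ∀ x ∈ C, ∀ y, ∃ z ∈ G.nbrsIn C x, z ≠ y) {i : ℕ} (hi' : i ≤ l)
    (hCi : C ⊆ L.below (i + 1)) : k ≤ C.ncard := by
  classical
  induction i with
  | zero =>
    obtain ⟨x, hx⟩ := hne
    obtain ⟨z, hz, hzx⟩ := hd x hx x
    have key : ∀ y ∈ C, y = L.vert 0 0 := by
      intro y hy
      obtain ⟨i', hi', j, hj, e⟩ := hCi hy
      obtain rfl : i' = 0 := by omega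
      rw [h.len_zero] at hj
      obtain rfl : j = 0 := by omega
      exact e
    exact (hzx ((key z hz.1).trans (key x hx).symm)).elim
  | succ i ih =>
    by_cases hex : ∃ x < L.len (i + 1), L.vert (i + 1) x ∈ C
    · have old : ∀ x < L.len (i + 1), ∀ u ∈ G.nbrsIn C (L.vert (i + 1) x),
          u ∈ L.below (i + 1) ∨ (x + 1 < L.len (i + 1) ∧ u = L.vert (i + 1) (x + 1)) ∨
            1 ≤ x ∧ u = L.vert (i + 1) (x - 1) := by
        intro x hx u hu
        obtain ⟨i', hi'', y, hy, e⟩ := hCi hu.1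
        rcases Nat.lt_succ_iff_lt_or_eq.1 hi'' with h1 | rfl
        · exact Or.inl ⟨i', h1, y, hy, e⟩
        · obtain ⟨-, hu⟩ := hu
          rw [e, h.path _ hi' x hx y hy] at hu
          rcases hu with rfl | rfl
          · exact Or.inr (Or.inl ⟨hy, e⟩)
          · exact Or.inr (Or.inr ⟨by omega, e⟩)
      -- At the first position `x` of the layer in `C` there is no left neighbor in `C`. Degree two
      -- then forces an ancestor in `C`, and, ancestors being unique, also the right neighbor.
      obtain ⟨x, ⟨hx, hxC⟩, hmin⟩ : ∃ x, (x < L.len (i + 1) ∧ L.vert (i + 1) x ∈ C) ∧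
          ∀ y < x, ¬ (y < L.len (i + 1) ∧ L.vert (i + 1) y ∈ C) :=
        ⟨Nat.find hex, Nat.find_spec hex, fun y hy => Nat.find_min hex hy⟩
      obtain ⟨u, hu, hux⟩ := hd _ hxC (L.vert (i + 1) (x + 1))
      have hu' : u ∈ L.below (i + 1) := by
        rcases old x hx u hu with h1 | h1 | h1
        · exact h1
        · exact (hux h1.2).elim
        · exact (hmin (x - 1) (by omega) ⟨by omega, h1.2 ▸ hu.1⟩).elim
      have hx1 : x + 1 < L.len (i + 1) ∧ L.vert (i + 1) (x + 1) ∈ C := by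
        obtain ⟨t, ht, htu⟩ := hd _ hxC u
        rcases old x hx t ht with h1 | h1 | h1
        · exact (htu (h.ancestors_subsingleton hi' x hx ⟨ht.2, h1⟩ ⟨hu.2, hu'⟩)).elim
        · exact ⟨h1.1, h1.2 ▸ ht.1⟩
        · exact (hmin (x - 1) (by omega) ⟨by omega, h1.2 ▸ ht.1⟩).elim
      have hex2 : ∃ y, x < y ∧ ¬ (y + 1 < L.len (i + 1) ∧ L.vert (i + 1) (y + 1) ∈ C) :=
        ⟨L.len (i + 1), hx, fun h => by omega⟩
      obtain ⟨y, ⟨hxy, hyC⟩, hmin2⟩ : ∃ y,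
          (x < y ∧ ¬ (y + 1 < L.len (i + 1) ∧ L.vert (i + 1) (y + 1) ∈ C)) ∧
          ∀ z < y, ¬ (x < z ∧ ¬ (z + 1 < L.len (i + 1) ∧ L.vert (i + 1) (z + 1) ∈ C)) :=
        ⟨Nat.find hex2, Nat.find_spec hex2, fun y hy => Nat.find_min hex2 hy⟩
      have hrun : ∀ z, x ≤ z → z ≤ y → z < L.len (i + 1) ∧ L.vert (i + 1) z ∈ C := by
        intro z h1 h2
        rcases Nat.eq_or_lt_of_le h1 with rfl | h1
        · exact ⟨hx, hxC⟩
        rcases Nat.eq_or_lt_of_le h1 with rfl | h1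
        · exact hx1
        have := hmin2 (z - 1) (by omega)
        push Not at this
        have := this (by omega)
        rwa [Nat.sub_add_cancel (by omega)] at this
      have hy := hrun y hxy.le le_rfl
      obtain ⟨u', hu1, hu2⟩ := hd _ hy.2 (L.vert (i + 1) (y - 1))
      have hu1' : u' ∈ L.below (i + 1) := by
        rcases old y hy.1 u' hu1 with h1 | h1 | h1
        · exact h1
        · exact (hyC ⟨h1.1, h1.2 ▸ hu1.1⟩).elim
        · exact (hu2 h1.2).elim
      have hle := h.le_sub (by omega) hxy hy.1 (h.vertexType_eq_one hi' hx hu' hu.2)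
        (h.vertexType_eq_one hi' hy.1 hu1' hu1.2)
      have hinj : Set.InjOn (L.vert (i + 1)) (Set.Icc x y) := fun z hz z' hz' e =>
        (h.inj _ hi' _ hi' z (hrun z hz.1 hz.2).1 z' (hrun z' hz'.1 hz'.2).1 e).2
      have hnot : u ∉ L.vert (i + 1) '' Set.Icc x y := by
        rintro ⟨z, hz, rfl⟩
        obtain ⟨i', h1, j, hj, e⟩ := hu'
        have := (h.inj _ hi' _ (by omega) z (hrun z hz.1 hz.2).1 j hj e).1
        omega
      -- The stretch has `y - x + 1 ≥ k - 1` vertices, and the ancestor `u` is the missing one.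
      have hsub : insert u (L.vert (i + 1) '' Set.Icc x y) ⊆ C := by
        refine Set.insert_subset hu.1 ?_
        rintro _ ⟨z, hz, rfl⟩
        exact (hrun z hz.1 hz.2).2
      have := Set.ncard_le_ncard hsub hC
      rw [Set.ncard_insert_of_notMem hnot ((Set.finite_Icc x y).image _),
        hinj.ncard_image, ← Nat.card_coe_set_eq, Nat.card_eq_fintype_card, Fintype.card_ofFinset,
        Nat.card_Icc] at this
      omega
    · push Not at hex
      refine ih (by omega) fun u hu => ?_
      obtain ⟨i', h1, j, hj, e⟩ := hCi hu
      rcases Nat.lt_succ_iff_lt_or_eq.1 h1 with h1 | rfl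
      · exact ⟨i', h1, j, hj, e⟩
      · exact (hex j hj (e ▸ hu)).elim

theorem le_egirth (h : IsTTFLayering G l k L lo hi) : (k : ℕ∞) ≤ G.egirth := by
  rw [SimpleGraph.le_egirth]
  intro a p hp
  -- The initial vertex of a closed walk reappears at its end, so the tail of the support already
  -- has all vertices.
  have hle : {x | x ∈ p.support}.ncard ≤ p.length := by
    classical
    have : {x | x ∈ p.support} = (p.support.tail.toFinset : Set V) := by
      ext x
      simp only [Set.mem_ofPred_eq, List.coe_toFinset, SimpleGraph.Walk.mem_support_iff]
      refine or_iff_right_of_imp ?_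
      rintro rfl
      exact SimpleGraph.Walk.end_mem_tail_support hp.not_nil
    rw [this, Set.ncard_coe_finset]
    exact (List.toFinset_card_le _).trans (by simp)
  refine le_trans ?_ (Nat.cast_le.2 hle)
  refine Nat.cast_le.2 (h.le_ncard (p.support.finite_toSet) ⟨a, p.start_mem_support⟩ ?_ le_rfl ?_)
  · intro x hx y
    have h2 := hp.ncard_neighborSet_toSubgraph_eq_two hx
    obtain ⟨z, hz, hzy⟩ := Set.exists_ne_of_one_lt_ncard (by rw [h2]; norm_num) y
    exact ⟨z, ⟨p.mem_verts_toSubgraph.1 (p.toSubgraph.edge_vert hz.symm), hz.adj_sub⟩, hzy⟩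
  · intro x _
    obtain ⟨i, hi, hx⟩ := h.cover x
    exact ⟨i, by omega, hx⟩

end IsTTFLayering

/-! ### Tight frames on the top layer: no branch vertices there. -/

open SimpleGraph ThetaFrame

/-- A tight theta frame in the graph formed by the layers up to the second one of a `BoxStep`. -/
structure TopFrame {V : Type*} (G : SimpleGraph V) (S : Set V) (a b : V) (c : V → Fin 3)
    (low old : Set V) (n m : ℕ) (w p : ℕ → V) (lo hi : ℕ → ℕ) : Prop where
  box : BoxStep G low old n m w p lo hi
  frame : ThetaFrame G S a b c
  tight : Tight G S a b
  sub : ∀ u ∈ S, u ∈ old ∨ ∃ x < m, u = p x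

namespace TopFrame

variable {V : Type*} {G : SimpleGraph V} {S : Set V} {a b : V} {c : V → Fin 3}
  {low old : Set V} {n m : ℕ} {w p : ℕ → V} {lo hi : ℕ → ℕ}

/-- The position `x` is occupied by a vertex of `S`. -/
def On (S : Set V) (m : ℕ) (p : ℕ → V) (x : ℕ) : Prop := x < m ∧ p x ∈ S

/-- All positions from `x` to `y` are occupied by vertices of `S`. -/
def Run (S : Set V) (m : ℕ) (p : ℕ → V) (x y : ℕ) : Prop := ∀ z, x ≤ z → z ≤ y → On S m p z

/-- No vertex strictly between the positions `x` and `y` has an ancestor in `S`. -/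
def Blank (G : SimpleGraph V) (S old : Set V) (p : ℕ → V) (x y : ℕ) : Prop :=
  ∀ z, x < z → z < y → ∀ u ∈ S, u ∈ old → ¬ G.Adj (p z) u

theorem hi_lt (B : BoxStep G low old n m w p lo hi) {j : ℕ} (hj : j < n) : hi j < m := by
  obtain ⟨d, hd⟩ : ∃ d, j + d + 1 = n := ⟨n - j - 1, by omega⟩
  induction d generalizing j with
  | zero =>
    have := B.hi_last
    obtain rfl : n - 1 = j := by omega
    omega
  | succ d ih =>
    have h1 := ih (j := j + 1) (by omega) (by omega)
    have h2 := B.hi_lt_lo j (by omega)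
    have h3 := B.lo_le_hi (j + 1) (by omega)
    omega

theorem hi_lt_lo_of_lt (B : BoxStep G low old n m w p lo hi) {j j' : ℕ} (hjj : j < j')
    (hj : j' < n) : hi j < lo j' := by
  induction j' with
  | zero => omega
  | succ j' ih =>
    have h2 := B.hi_lt_lo j' hj
    rcases Nat.lt_succ_iff_lt_or_eq.1 hjj with h | rfl
    · have h1 := ih h (by omega)
      have h3 := B.lo_le_hi j' (by omega)
      omega
    · exact h2

theorem box_unique (B : BoxStep G low old n m w p lo hi) {j j' x : ℕ} (hj : j < n) (hj' : j' < n)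
    (h1 : lo j ≤ x) (h2 : x ≤ hi j) (h1' : lo j' ≤ x) (h2' : x ≤ hi j') : j = j' := by
  rcases lt_trichotomy j j' with h | h | h
  · have := hi_lt_lo_of_lt B h hj'
    omega
  · exact h
  · have := hi_lt_lo_of_lt B h hj
    omega

theorem mem_box (B : BoxStep G low old n m w p lo hi) {x : ℕ} (hx : x < m) {u : V}
    (hu : u ∈ old) (e : G.Adj (p x) u) : ∃ j < n, lo j ≤ x ∧ x ≤ hi j := by
  by_contra! hc
  exact B.outside x hx (fun j hj h => absurd (hc j hj h.1) (by omega)) u hu e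

/-- An ancestor `u` of `p x` belongs to the box of `x`, and `x` lies in a triple of `u`. -/
theorem exists_triple (B : BoxStep G low old n m w p lo hi) {x : ℕ} (hx : x < m) {u : V}
    (hu : u ∈ old) (e : G.Adj (p x) u) :
    ∃ j < n, (u = w j ∨ u ∈ low ∧ G.Adj (w j) u) ∧ ∃ y₁ y₂ y₃, lo j ≤ y₁ ∧ y₁ < y₂ ∧ y₂ < y₃ ∧
      y₃ ≤ hi j ∧ (x = y₁ ∨ x = y₂ ∨ x = y₃) ∧ G.Adj (p y₁) u ∧ G.Adj (p y₂) u ∧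
      G.Adj (p y₃) u ∧ Blank G Set.univ old p y₁ y₂ ∧ Blank G Set.univ old p y₂ y₃ ∧
      ∀ u' ∈ old, G.Adj (p x) u' → u' = u := by
  obtain ⟨j, hj, h1, h2⟩ := mem_box B hx hu e
  have hwj : w j ∈ old := (B.mem_old _).2 (Or.inr ⟨j, hj, rfl⟩)
  by_cases ht : ∃ v ∈ low, G.Adj (w j) v
  · obtain ⟨v, hv, ev⟩ := ht
    have hvo : v ∈ old := (B.mem_old _).2 (Or.inl hv)
    obtain ⟨y₁, y₂, y₃, y₄, y₅, y₆, y₇, l1, l2, l3, l4, l5, l6, l7, l8, hq⟩ :=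
      B.box_one j hj v hv ev
    have hw : ∀ y, (y = lo j ∨ y = y₁ ∨ y = y₂ ∨ y = y₆ ∨ y = y₇ ∨ y = hi j) →
        G.Adj (p y) (w j) := fun y hy =>
      (hq y (by omega) (by omega) _ hwj).2 (Or.inl ⟨rfl, hy⟩)
    have hv' : ∀ y, (y = y₃ ∨ y = y₄ ∨ y = y₅) → G.Adj (p y) v := fun y hy =>
      (hq y (by omega) (by omega) _ hvo).2 (Or.inr ⟨rfl, hy⟩)
    have hblank : ∀ y y', lo j ≤ y → y' ≤ hi j →
        (∀ z, y < z → z < y' → z ≠ lo j ∧ z ≠ y₁ ∧ z ≠ y₂ ∧ z ≠ y₃ ∧ z ≠ y₄ ∧ z ≠ y₅ ∧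
          z ≠ y₆ ∧ z ≠ y₇ ∧ z ≠ hi j) → Blank G Set.univ old p y y' := by
      intro y y' hy hy' hz z h3 h4 u' _ hu' e'
      have h5 := (hq z (by omega) (by omega) _ hu').1 e'
      have h6 := hz z h3 h4
      omega
    have hun : ∀ u' ∈ old, G.Adj (p x) u' → u' = u := by
      intro u' hu' e'
      rcases (hq x h1 h2 u hu).1 e with ⟨e1, e2⟩ | ⟨e1, e2⟩ <;>
        rcases (hq x h1 h2 u' hu').1 e' with ⟨e1', e2'⟩ | ⟨e1', e2'⟩
      · rw [e1, e1']
      · omega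
      · omega
      · rw [e1, e1']
    refine ⟨j, hj, ?_⟩
    rcases (hq x h1 h2 u hu).1 e with ⟨rfl, hx'⟩ | ⟨rfl, hx'⟩
    · refine ⟨Or.inl rfl, ?_⟩
      -- The six neighbors of `w j` form two triples, one on each side of the triple of `v`.
      by_cases hc : x ≤ y₂
      · exact ⟨lo j, y₁, y₂, le_rfl, l1, l2, by omega, by omega, hw _ (by omega), hw _ (by omega),
          hw _ (by omega), hblank _ _ (by omega) (by omega) (by omega),
          hblank _ _ (by omega) (by omega) (by omega), hun⟩
      · exact ⟨y₆, y₇, hi j, by omega, l7, l8, le_rfl, by omega, hw _ (by omega), hw _ (by omega),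
          hw _ (by omega), hblank _ _ (by omega) (by omega) (by omega),
          hblank _ _ (by omega) (by omega) (by omega), hun⟩
    · exact ⟨Or.inr ⟨hv, ev⟩, y₃, y₄, y₅, by omega, l4, l5, by omega, hx', hv' _ (by omega),
        hv' _ (by omega), hv' _ (by omega), hblank _ _ (by omega) (by omega) (by omega),
        hblank _ _ (by omega) (by omega) (by omega), hun⟩
  · push Not at ht
    obtain ⟨y, l1, l2, hq⟩ := B.box_zero j hj ht
    obtain ⟨rfl, hx'⟩ := (hq x h1 h2 u hu).1 e
    have hw : ∀ z, (z = lo j ∨ z = y ∨ z = hi j) → G.Adj (p z) (w j) := fun z hz =>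
      (hq z (by omega) (by omega) _ hwj).2 ⟨rfl, hz⟩
    have hblank : ∀ y₁ y₂, lo j ≤ y₁ → y₂ ≤ hi j →
        (∀ z, y₁ < z → z < y₂ → z ≠ lo j ∧ z ≠ y ∧ z ≠ hi j) →
        Blank G Set.univ old p y₁ y₂ := by
      intro y y' hy hy' hz z h3 h4 u' _ hu' e'
      have h5 := (hq z (by omega) (by omega) _ hu').1 e'
      have h6 := hz z h3 h4
      omega
    exact ⟨j, hj, Or.inl rfl, lo j, y, hi j, le_rfl, l1, l2, le_rfl, hx', hw _ (by omega),
      hw _ (by omega), hw _ (by omega), hblank _ _ (by omega) (by omega) (by omega),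
      hblank _ _ (by omega) (by omega) (by omega), fun u' hu' e' => ((hq x h1 h2 u' hu').1 e').1⟩

theorem adj_lo (B : BoxStep G low old n m w p lo hi) {j : ℕ} (hj : j < n) :
    G.Adj (p (lo j)) (w j) ∧ G.Adj (p (hi j)) (w j) := by
  have hwj : w j ∈ old := (B.mem_old _).2 (Or.inr ⟨j, hj, rfl⟩)
  have hle := B.lo_le_hi j hj
  by_cases ht : ∃ v ∈ low, G.Adj (w j) v
  · obtain ⟨v, hv, ev⟩ := ht
    obtain ⟨y₁, y₂, y₃, y₄, y₅, y₆, y₇, l1, l2, l3, l4, l5, l6, l7, l8, hq⟩ :=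
      B.box_one j hj v hv ev
    exact ⟨(hq _ le_rfl hle _ hwj).2 (Or.inl ⟨rfl, by omega⟩),
      (hq _ hle le_rfl _ hwj).2 (Or.inl ⟨rfl, by omega⟩)⟩
  · push Not at ht
    obtain ⟨y, l1, l2, hq⟩ := B.box_zero j hj ht
    exact ⟨(hq _ le_rfl hle _ hwj).2 ⟨rfl, by omega⟩, (hq _ hle le_rfl _ hwj).2 ⟨rfl, by omega⟩⟩

theorem ancestor_unique (B : BoxStep G low old n m w p lo hi) {x : ℕ} (hx : x < m) {u v : V}
    (hu : u ∈ old) (hv : v ∈ old) (e : G.Adj (p x) u) (e' : G.Adj (p x) v) : v = u := by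
  obtain ⟨-, -, -, -, -, -, -, -, -, -, -, -, -, -, -, -, h⟩ := exists_triple B hx hu e
  exact h v hv e'

variable (h : TopFrame G S a b c low old n m w p lo hi)
include h

theorem mem_nbrsIn {x : ℕ} (hx : x < m) {t : V} (ht : t ∈ nbrsIn G S (p x)) :
    t ∈ old ∨ (On S m p (x + 1) ∧ t = p (x + 1)) ∨ ∃ y, y + 1 = x ∧ On S m p y ∧ t = p y := by
  obtain ⟨h1, h2⟩ := ht
  rcases h.sub t h1 with h3 | ⟨y, hy, rfl⟩
  · exact Or.inl h3
  · rcases (h.box.p_adj x hx y hy).1 h2 with rfl | rfl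
    · exact Or.inr (Or.inl ⟨⟨hy, h1⟩, rfl⟩)
    · exact Or.inr (Or.inr ⟨y, rfl, ⟨hy, h1⟩, rfl⟩)

theorem adj_succ {x : ℕ} (hx : x + 1 < m) : G.Adj (p x) (p (x + 1)) :=
  (h.box.p_adj x (by omega) (x + 1) hx).2 (Or.inl rfl)

theorem p_ne {x y : ℕ} (hx : x < m) (hy : y < m) (hxy : x ≠ y) : p x ≠ p y :=
  fun e => hxy (h.box.p_inj x hx y hy e)

theorem p_ne_old {x : ℕ} (hx : x < m) {u : V} (hu : u ∈ old) : p x ≠ u :=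
  fun e => h.box.p_not_old x hx (e ▸ hu)

/-- A vertex of `S` in the last layer without ancestor in `S` has both its neighbors on the layer
in `S`. -/
theorem on_succ_of_not_hit {x : ℕ} (hx : On S m p x)
    (h0 : ∀ u ∈ S, u ∈ old → ¬ G.Adj (p x) u) : On S m p (x + 1) := by
  by_contra hc
  obtain ⟨t, ht, -⟩ := h.frame.exists_ne hx.2 a
  obtain ⟨t', ht', hne⟩ := h.frame.exists_ne hx.2 t
  rcases h.mem_nbrsIn hx.1 ht with h1 | h1 | ⟨y, hy, -, e⟩
  · exact h0 t ht.1 h1 ht.2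
  · exact hc h1.1
  rcases h.mem_nbrsIn hx.1 ht' with h1 | h1 | ⟨y', hy', -, e'⟩
  · exact h0 t' ht'.1 h1 ht'.2
  · exact hc h1.1
  · obtain rfl : y = y' := by omega
    exact hne (e'.trans e.symm)

theorem on_pred_of_not_hit {x : ℕ} (hx : On S m p x)
    (h0 : ∀ u ∈ S, u ∈ old → ¬ G.Adj (p x) u) : ∃ y, y + 1 = x ∧ On S m p y := by
  obtain ⟨t', ht', hne⟩ := h.frame.exists_ne hx.2 (p (x + 1))
  rcases h.mem_nbrsIn hx.1 ht' with h1 | h1 | ⟨y', hy', h2, e'⟩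
  · exact (h0 t' ht'.1 h1 ht'.2).elim
  · exact (hne h1.2).elim
  · exact ⟨y', hy', h2⟩

theorem on_succ_or {x : ℕ} (hx : On S m p x) :
    On S m p (x + 1) ∨ ∃ y, y + 1 = x ∧ On S m p y := by
  by_cases h0 : ∃ u ∈ S, u ∈ old ∧ G.Adj (p x) u
  · obtain ⟨u, hu, huo, e⟩ := h0
    obtain ⟨t', ht', hne⟩ := h.frame.exists_ne hx.2 u
    rcases h.mem_nbrsIn hx.1 ht' with h1 | h1 | ⟨y', hy', h2, e'⟩
    · exact (hne (ancestor_unique h.box hx.1 huo h1 e ht'.2)).elim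
    · exact Or.inl h1.1
    · exact Or.inr ⟨y', hy', h2⟩
  · push Not at h0
    exact Or.inl (h.on_succ_of_not_hit hx h0)

theorem run_right {x y : ℕ} (hx : On S m p x)
    (h0 : ∀ z, x ≤ z → z < y → ∀ u ∈ S, u ∈ old → ¬ G.Adj (p z) u) : Run S m p x y := by
  intro z h1
  induction z, h1 using Nat.le_induction with
  | base => exact fun _ => hx
  | succ z hz ih => exact fun h2 => h.on_succ_of_not_hit (ih (by omega)) (h0 z hz h2)

theorem run_left {x y : ℕ} (hy : On S m p y)
    (h0 : ∀ z, x < z → z ≤ y → ∀ u ∈ S, u ∈ old → ¬ G.Adj (p z) u) : Run S m p x y := by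
  intro z h1 h2
  obtain ⟨d, rfl⟩ := Nat.exists_eq_add_of_le h2
  induction d generalizing z with
  | zero => exact hy
  | succ d ih =>
    have h3 := ih (z + 1) (by omega) (by rwa [show z + 1 + d = z + (d + 1) by omega])
      (by rwa [show z + 1 + d = z + (d + 1) by omega]) (by omega)
    obtain ⟨y, hy, h4⟩ := h.on_pred_of_not_hit h3 (h0 (z + 1) (by omega) (by omega))
    obtain rfl : y = z := by omega
    exact h4

theorem run_of_on {x y z : ℕ} (h1 : x < z) (h2 : z < y) (hz : On S m p z)
    (h0 : Blank G S old p x y) : Run S m p x y := by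
  intro t h3 h4
  rcases le_total t z with h5 | h5
  · exact h.run_left (x := x) hz (fun s hs hs' => h0 s hs (by omega)) t h3 h5
  · exact h.run_right (y := y) hz (fun s hs hs' => h0 s (by omega) hs') t h5 h4

theorem run_of_on_succ {x y : ℕ} (h1 : x < y) (hx : On S m p x) (hx' : On S m p (x + 1))
    (h0 : Blank G S old p x y) : Run S m p x y := by
  rcases Nat.eq_or_lt_of_le (show x + 1 ≤ y from h1) with rfl | h2
  · intro t h3 h4
    rcases Nat.eq_or_lt_of_le h3 with rfl | h5
    · exact hx
    · obtain rfl : t = x + 1 := by omega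
      exact hx'
  · exact h.run_of_on (Nat.lt_succ_self x) h2 hx' h0

theorem run_of_on_pred {x y z : ℕ} (h1 : x < y) (hy : On S m p y) (e : z + 1 = y)
    (hz : On S m p z) (h0 : Blank G S old p x y) : Run S m p x y := by
  rcases Nat.eq_or_lt_of_le (show x ≤ z by omega) with rfl | h2
  · exact h.run_of_on_succ h1 hz (e ▸ hy) h0
  · exact h.run_of_on h2 (by omega) hz h0

theorem col_run {x y : ℕ} (hr : Run S m p x y)
    (hb : ∀ z, x ≤ z → z ≤ y → ¬ (p z = a ∨ p z = b)) :
    ∀ z, x ≤ z → z ≤ y → c (p z) = c (p x) := by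
  intro z h1
  induction z, h1 using Nat.le_induction with
  | base => exact fun _ => rfl
  | succ z hz ih =>
    intro h2
    rw [← ih (by omega)]
    have h3 := hr z hz (by omega)
    have h4 := hr (z + 1) (by omega) h2
    exact h.frame.col_eq h4.2 h3.2 (hb _ (by omega) h2) (hb _ hz (by omega))
      (h.adj_succ h4.1).symm

/-- A branch vertex has three neighbors in `S`, and the layer supplies at most two. For `x = 0` the
truncated `x - 1` names `p x` itself, whose exclusion costs nothing. -/
theorem not_branch_of_not_hit {x : ℕ} (hx : On S m p x)
    (h0 : ∀ u ∈ S, u ∈ old → ¬ G.Adj (p x) u) : ¬ (p x = a ∨ p x = b) := by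
  intro hb
  obtain ⟨t', ht', hne, hne'⟩ := h.frame.exists_ne_ne hb (p (x + 1)) (p (x - 1))
  rcases h.mem_nbrsIn hx.1 ht' with h1 | h1 | ⟨y', rfl, h2, e'⟩
  · exact h0 t' ht'.1 h1 ht'.2
  · exact hne h1.2
  · exact hne' e'

theorem col_run' {x y : ℕ} (hxy : x < y) (hr : Run S m p x y) (h0 : Blank G S old p x y)
    (hbx : ¬ (p x = a ∨ p x = b)) (hby : ¬ (p y = a ∨ p y = b)) :
    (∀ z, x ≤ z → z ≤ y → ¬ (p z = a ∨ p z = b)) ∧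
    ∀ z, x ≤ z → z ≤ y → c (p z) = c (p x) := by
  have hb : ∀ z, x ≤ z → z ≤ y → ¬ (p z = a ∨ p z = b) := by
    intro z h1 h2
    rcases Nat.eq_or_lt_of_le h1 with rfl | h3
    · exact hbx
    rcases Nat.eq_or_lt_of_le h2 with rfl | h4
    · exact hby
    exact h.not_branch_of_not_hit (hr z h1 h2) (h0 z h3 h4)
  exact ⟨hb, h.col_run hr hb⟩

/-- In a run between two consecutive vertices with ancestors in `S`, the neighbors of the
vertices of the run are those ancestors and the vertices of the run. -/
theorem nbrs_run {x y : ℕ} (hxy : x < y) (hr : Run S m p x y) (h0 : Blank G S old p x y)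
    {s t : V} (hs : s ∈ S) (hso : s ∈ old) (hxs : G.Adj (p x) s)
    (ht : t ∈ S) (hto : t ∈ old) (hyt : G.Adj (p y) t)
    {z : ℕ} (h1 : x ≤ z) (h2 : z ≤ y) (hb : ¬ (p z = a ∨ p z = b)) :
    ∀ v ∈ nbrsIn G S (p z), v ∈ p '' Set.Icc x y ∨ (z = x ∧ v = s) ∨ (z = y ∧ v = t) := by
  intro v hv
  rcases Nat.eq_or_lt_of_le h1 with rfl | h3
  · have hx1 := hr (x + 1) (by omega) hxy
    rcases h.frame.eq_or_eq (hr x le_rfl hxy.le).2 hb ⟨hs, hxs⟩ ⟨hx1.2, h.adj_succ hx1.1⟩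
      (h.p_ne_old hx1.1 hso).symm hv with rfl | rfl
    · exact Or.inr (Or.inl ⟨rfl, rfl⟩)
    · exact Or.inl ⟨x + 1, ⟨by omega, by omega⟩, rfl⟩
  rcases Nat.eq_or_lt_of_le h2 with rfl | h4
  · have hy1 := hr (z - 1) (by omega) (by omega)
    have hz := hr z h1 le_rfl
    have e := h.adj_succ (x := z - 1) (by have := hz.1; omega)
    rw [Nat.sub_add_cancel (by omega)] at e
    rcases h.frame.eq_or_eq hz.2 hb ⟨ht, hyt⟩ ⟨hy1.2, e.symm⟩
      (h.p_ne_old hy1.1 hto).symm hv with rfl | rfl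
    · exact Or.inr (Or.inr ⟨rfl, rfl⟩)
    · exact Or.inl ⟨z - 1, ⟨by omega, by omega⟩, rfl⟩
  rcases h.mem_nbrsIn (hr z h1 h2).1 hv with h5 | ⟨-, rfl⟩ | ⟨y', rfl, -, rfl⟩
  · exact (h0 z h3 h4 v hv.1 h5 hv.2).elim
  · exact Or.inl ⟨z + 1, ⟨by omega, by omega⟩, rfl⟩
  · exact Or.inl ⟨y', ⟨by omega, by omega⟩, rfl⟩

/-- A run between two neighbors of a vertex of `S`. -/
theorem branch_of_run {x y : ℕ} (hxy : x < y) (hr : Run S m p x y) (h0 : Blank G S old p x y)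
    {u : V} (hu : u ∈ S) (huo : u ∈ old) (hxu : G.Adj (p x) u) (hyu : G.Adj (p y) u) :
    (p x = a ∨ p x = b) ∧ (p y = a ∨ p y = b) := by
  have hx := hr x le_rfl hxy.le
  have hy := hr y hxy.le le_rfl
  have hne := h.p_ne hx.1 hy.1 hxy.ne
  -- The run and `u` form a cycle whose only possible branch vertices are `u`, `p x` and `p y`,
  -- since inner vertices of the run have no ancestor in `S`. As `u` is adjacent to both ends and
  -- branch vertices are not adjacent, either the ends are the two branch vertices or there is at
  -- most one on the cycle. In the latter cases `no_cycle` applies with `z` a vertex carrying the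
  -- possible exception and `T` the rest of the cycle.
  by_cases hbx : p x = a ∨ p x = b
  · refine ⟨hbx, ?_⟩
    by_contra hby
    have hbu : ¬ (u = a ∨ u = b) := h.frame.not_branch_of_adj hbx hxu
    have hb : ∀ z, x + 1 ≤ z → z ≤ y → ¬ (p z = a ∨ p z = b) := by
      intro z h1 h2
      rcases Nat.eq_or_lt_of_le h2 with rfl | h4
      · exact hby
      exact h.not_branch_of_not_hit (hr z (by omega) h2) (h0 z h1 h4)
    have hcol := h.col_run (x := x + 1) (y := y) (fun z h1 h2 => hr z (by omega) h2) hb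
    have hcu : c u = c (p (x + 1)) := by
      rw [← hcol y hxy le_rfl]
      exact h.frame.col_eq hu hy.2 hbu hby hyu.symm
    have hx1 := hr (x + 1) (by omega) hxy
    refine h.frame.no_cycle h.tight (T := insert u (p '' Set.Icc (x + 1) y)) (z := p x)
      (y := u) (y' := p (x + 1)) ?_ ?_ ?_ ?_ hx.2 (Or.inl rfl)
      (Or.inr ⟨x + 1, ⟨le_rfl, hxy⟩, rfl⟩) (h.p_ne_old hx1.1 huo).symm hxu (h.adj_succ hx1.1)
    · rintro _ (rfl | ⟨z, hz, rfl⟩)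
      exacts [hu, (hr z (by have := hz.1; omega) hz.2).2]
    · rintro _ (rfl | ⟨z, hz, rfl⟩)
      exacts [hbu, hb z hz.1 hz.2]
    · have : ∀ t ∈ insert u (p '' Set.Icc (x + 1) y), c t = c (p (x + 1)) := by
        rintro _ (rfl | ⟨z, hz, rfl⟩)
        exacts [hcu, hcol z hz.1 hz.2]
      intro t ht t' ht'
      rw [this t ht, this t' ht']
    · rintro _ (rfl | ⟨z, hz, rfl⟩) t ht
      · rcases h.frame.eq_or_eq hu hbu ⟨hx.2, hxu.symm⟩ ⟨hy.2, hyu.symm⟩ hne ht with rfl | rfl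
        exacts [Or.inr rfl, Or.inl (Or.inr ⟨y, ⟨hxy, le_rfl⟩, rfl⟩)]
      · have hz1 := hz.1
        rcases h.nbrs_run hxy hr h0 hu huo hxu hu huo hyu (z := z) (by omega) hz.2
          (hb z hz.1 hz.2) t ht with ⟨s, hs, rfl⟩ | ⟨-, rfl⟩ | ⟨-, rfl⟩
        · rcases Nat.eq_or_lt_of_le hs.1 with rfl | h4
          exacts [Or.inr rfl, Or.inl (Or.inr ⟨s, ⟨h4, hs.2⟩, rfl⟩)]
        · exact Or.inl (Or.inl rfl)
        · exact Or.inl (Or.inl rfl)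
  · exfalso
    by_cases hby : p y = a ∨ p y = b
    · have hbu : ¬ (u = a ∨ u = b) := h.frame.not_branch_of_adj hby hyu
      have hb : ∀ z, x ≤ z → z ≤ y - 1 → ¬ (p z = a ∨ p z = b) := by
        intro z h1 h2
        rcases Nat.eq_or_lt_of_le h1 with rfl | h4
        · exact hbx
        exact h.not_branch_of_not_hit (hr z (by omega) (by omega)) (h0 z h4 (by omega))
      have hcol := h.col_run (x := x) (y := y - 1) (fun z h1 h2 => hr z h1 (by omega)) hb
      have hcu : c u = c (p x) := h.frame.col_eq hu hx.2 hbu hbx hxu.symm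
      have hy1 := hr (y - 1) (by omega) (by omega)
      have ey := h.adj_succ (x := y - 1) (by have := hy.1; omega)
      rw [Nat.sub_add_cancel (by omega)] at ey
      refine h.frame.no_cycle h.tight (T := insert u (p '' Set.Icc x (y - 1))) (z := p y)
        (y := u) (y' := p (y - 1)) ?_ ?_ ?_ ?_ hy.2 (Or.inl rfl)
        (Or.inr ⟨y - 1, ⟨by omega, le_rfl⟩, rfl⟩) (h.p_ne_old hy1.1 huo).symm hyu ey.symm
      · rintro _ (rfl | ⟨z, hz, rfl⟩)
        exacts [hu, (hr z hz.1 (by have := hz.2; omega)).2]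
      · rintro _ (rfl | ⟨z, hz, rfl⟩)
        exacts [hbu, hb z hz.1 hz.2]
      · have : ∀ t ∈ insert u (p '' Set.Icc x (y - 1)), c t = c (p x) := by
          rintro _ (rfl | ⟨z, hz, rfl⟩)
          exacts [hcu, hcol z hz.1 hz.2]
        intro t ht t' ht'
        rw [this t ht, this t' ht']
      · rintro _ (rfl | ⟨z, hz, rfl⟩) t ht
        · rcases h.frame.eq_or_eq hu hbu ⟨hx.2, hxu.symm⟩ ⟨hy.2, hyu.symm⟩ hne ht with rfl | rfl
          exacts [Or.inl (Or.inr ⟨x, ⟨le_rfl, by omega⟩, rfl⟩), Or.inr rfl]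
        · have hz2 := hz.2
          rcases h.nbrs_run hxy hr h0 hu huo hxu hu huo hyu (z := z) hz.1 (by omega)
            (hb z hz.1 hz.2) t ht with ⟨s, hs, rfl⟩ | ⟨-, rfl⟩ | ⟨-, rfl⟩
          · rcases Nat.eq_or_lt_of_le hs.2 with rfl | h4
            exacts [Or.inr rfl, Or.inl (Or.inr ⟨s, ⟨hs.1, by omega⟩, rfl⟩)]
          · exact Or.inl (Or.inl rfl)
          · exact Or.inl (Or.inl rfl)
    · obtain ⟨hb, hcol⟩ := h.col_run' hxy hr h0 hbx hby
      refine h.frame.no_cycle h.tight (T := p '' Set.Icc x y) (z := u) (y := p x) (y' := p y)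
        ?_ ?_ ?_ ?_ hu ⟨x, ⟨le_rfl, hxy.le⟩, rfl⟩ ⟨y, ⟨hxy.le, le_rfl⟩, rfl⟩ hne hxu.symm hyu.symm
      · rintro _ ⟨z, hz, rfl⟩
        exact (hr z hz.1 hz.2).2
      · rintro _ ⟨z, hz, rfl⟩
        exact hb z hz.1 hz.2
      · rintro _ ⟨z, hz, rfl⟩ _ ⟨z', hz', rfl⟩
        rw [hcol z hz.1 hz.2, hcol z' hz'.1 hz'.2]
      · rintro _ ⟨z, hz, rfl⟩ t ht
        rcases h.nbrs_run hxy hr h0 hu huo hxu hu huo hyu hz.1 hz.2 (hb z hz.1 hz.2) t ht with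
          h1 | ⟨-, rfl⟩ | ⟨-, rfl⟩
        exacts [Or.inl h1, Or.inr rfl, Or.inr rfl]

/-- There is no run between neighbors of two adjacent vertices of `S`. -/
theorem not_run_of_adj {x y : ℕ} (hxy : x < y) (hr : Run S m p x y) (h0 : Blank G S old p x y)
    (hbx : ¬ (p x = a ∨ p x = b)) (hby : ¬ (p y = a ∨ p y = b))
    {s t : V} (hs : s ∈ S) (hso : s ∈ old) (hxs : G.Adj (p x) s)
    (ht : t ∈ S) (hto : t ∈ old) (hyt : G.Adj (p y) t) : ¬ G.Adj s t := by
  intro est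
  obtain ⟨hb, hcol⟩ := h.col_run' hxy hr h0 hbx hby
  have hx := hr x le_rfl hxy.le
  have hy := hr y hxy.le le_rfl
  -- The run and the edge `s t` form a cycle. Being adjacent, `s` and `t` are not both branch
  -- vertices, so one of them can serve as the exceptional `z` of `no_cycle`.
  by_cases hbs : s = a ∨ s = b
  · have hbt := h.frame.not_branch_of_adj hbs est
    have hct : c t = c (p x) := by
      rw [← hcol y hxy.le le_rfl]
      exact h.frame.col_eq ht hy.2 hbt hby hyt.symm
    refine h.frame.no_cycle h.tight (T := insert t (p '' Set.Icc x y)) (z := s) (y := t)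
        (y' := p x) ?_ ?_ ?_ ?_ hs (Or.inl rfl) (Or.inr ⟨x, ⟨le_rfl, hxy.le⟩, rfl⟩)
        (h.p_ne_old hx.1 hto).symm est hxs.symm
    · rintro _ (rfl | ⟨z, hz, rfl⟩)
      exacts [ht, (hr z hz.1 hz.2).2]
    · rintro _ (rfl | ⟨z, hz, rfl⟩)
      exacts [hbt, hb z hz.1 hz.2]
    · have : ∀ v ∈ insert t (p '' Set.Icc x y), c v = c (p x) := by
        rintro _ (rfl | ⟨z, hz, rfl⟩)
        exacts [hct, hcol z hz.1 hz.2]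
      intro t ht t' ht'
      rw [this t ht, this t' ht']
    · rintro _ (rfl | ⟨z, hz, rfl⟩) v hv
      · rcases h.frame.eq_or_eq ht hbt ⟨hs, est.symm⟩ ⟨hy.2, hyt.symm⟩ (h.p_ne_old hy.1 hso).symm
          hv with rfl | rfl
        exacts [Or.inr rfl, Or.inl (Or.inr ⟨y, ⟨hxy.le, le_rfl⟩, rfl⟩)]
      · rcases h.nbrs_run hxy hr h0 hs hso hxs ht hto hyt hz.1 hz.2 (hb z hz.1 hz.2) v hv with
          h1 | ⟨-, rfl⟩ | ⟨-, rfl⟩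
        exacts [Or.inl (Or.inr h1), Or.inr rfl, Or.inl (Or.inl rfl)]
  · have hcs : c s = c (p x) := h.frame.col_eq hs hx.2 hbs hbx hxs.symm
    refine h.frame.no_cycle h.tight (T := insert s (p '' Set.Icc x y)) (z := t) (y := s)
        (y' := p y) ?_ ?_ ?_ ?_ ht (Or.inl rfl) (Or.inr ⟨y, ⟨hxy.le, le_rfl⟩, rfl⟩)
        (h.p_ne_old hy.1 hso).symm est.symm hyt.symm
    · rintro _ (rfl | ⟨z, hz, rfl⟩)
      exacts [hs, (hr z hz.1 hz.2).2]
    · rintro _ (rfl | ⟨z, hz, rfl⟩)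
      exacts [hbs, hb z hz.1 hz.2]
    · have : ∀ v ∈ insert s (p '' Set.Icc x y), c v = c (p x) := by
        rintro _ (rfl | ⟨z, hz, rfl⟩)
        exacts [hcs, hcol z hz.1 hz.2]
      intro t ht t' ht'
      rw [this t ht, this t' ht']
    · rintro _ (rfl | ⟨z, hz, rfl⟩) v hv
      · rcases h.frame.eq_or_eq hs hbs ⟨ht, est⟩ ⟨hx.2, hxs.symm⟩ (h.p_ne_old hx.1 hto).symm
          hv with rfl | rfl
        exacts [Or.inr rfl, Or.inl (Or.inr ⟨x, ⟨le_rfl, hxy.le⟩, rfl⟩)]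
      · rcases h.nbrs_run hxy hr h0 hs hso hxs ht hto hyt hz.1 hz.2 (hb z hz.1 hz.2) v hv with
          h1 | ⟨-, rfl⟩ | ⟨-, rfl⟩
        exacts [Or.inl (Or.inr h1), Or.inl (Or.inl rfl), Or.inr rfl]

/-- The vertices of `S` in a triple of a vertex of `S`. -/
theorem triple {x y z : ℕ} (hxy : x < y) (hyz : y < z) (hzm : z < m) {u : V} (hu : u ∈ S)
    (huo : u ∈ old) (hxu : G.Adj (p x) u) (hyu : G.Adj (p y) u) (hzu : G.Adj (p z) u)
    (h1 : Blank G S old p x y) (h2 : Blank G S old p y z) :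
    ¬ On S m p y ∧ (On S m p x → ¬ On S m p (x + 1)) ∧ (On S m p z → ¬ On S m p (z - 1)) := by
  have three : ∀ s t r : ℕ, s < t → t < r → r < m → (p s = a ∨ p s = b) →
      (p t = a ∨ p t = b) → (p r = a ∨ p r = b) → False := by
    intro s t r h1 h2 h3 hs ht hr
    have e1 := h.p_ne (x := s) (y := t) (by omega) (by omega) (by omega)
    have e2 := h.p_ne (x := t) (y := r) (by omega) (by omega) (by omega)
    have e3 := h.p_ne (x := s) (y := r) (by omega) (by omega) (by omega)
    grind
  have hboth : Run S m p x y → Run S m p y z → False := by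
    intro r1 r2
    have b1 := h.branch_of_run hxy r1 h1 hu huo hxu hyu
    have b2 := h.branch_of_run hyz r2 h2 hu huo hyu hzu
    exact three x y z hxy hyz hzm b1.1 b1.2 b2.2
  -- With this run `p y` is a branch vertex. Its third neighbor, other than `u` and the left one,
  -- can only be the right one because `u` is its only ancestor. So the other half is a run too, and
  -- there would be three branch vertices.
  have n1 : ¬ Run S m p x y := by
    intro r1
    have b1 := h.branch_of_run hxy r1 h1 hu huo hxu hyu
    have hy := r1 y hxy.le le_rfl
    obtain ⟨t, ht, ht1, ht2⟩ := h.frame.exists_ne_ne b1.2 u (p (y - 1))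
    rcases h.mem_nbrsIn hy.1 ht with h3 | ⟨h3, -⟩ | ⟨y, rfl, -, e⟩
    · exact ht1 (ancestor_unique h.box hy.1 huo h3 hyu ht.2)
    · exact hboth r1 (h.run_of_on_succ hyz hy h3 h2)
    · exact ht2 e
  have n2 : ¬ Run S m p y z := by
    intro r1
    have b1 := h.branch_of_run hyz r1 h2 hu huo hyu hzu
    have hy := r1 y le_rfl hyz.le
    obtain ⟨t, ht, ht1, ht2⟩ := h.frame.exists_ne_ne b1.1 u (p (y + 1))
    rcases h.mem_nbrsIn hy.1 ht with h3 | ⟨-, h3⟩ | ⟨y', e, h3, -⟩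
    · exact ht1 (ancestor_unique h.box hy.1 huo h3 hyu ht.2)
    · exact ht2 h3
    · exact hboth (h.run_of_on_pred hxy hy e h3 h1) r1
  refine ⟨fun hy => ?_, fun hx hx' => n1 (h.run_of_on_succ hxy hx hx' h1),
    fun hz hz' => n2 (h.run_of_on_pred hyz hz (Nat.sub_add_cancel (by omega)) hz' h2)⟩
  rcases h.on_succ_or hy with h3 | ⟨y', e, h3⟩
  · exact n2 (h.run_of_on_succ hyz hy h3 h2)
  · exact n1 (h.run_of_on_pred hxy hy e h3 h1)

/-- Degree three requires the unique ancestor and both neighbors on the layer. By `triple`, a vertex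
of `S` with an ancestor in `S` is an outer vertex of a triple and lacks its inner neighbor on the
layer. -/
theorem not_branch {x : ℕ} (hx : On S m p x) : ¬ (p x = a ∨ p x = b) := by
  by_cases h0 : ∃ u ∈ S, u ∈ old ∧ G.Adj (p x) u
  · obtain ⟨u, hu, huo, e⟩ := h0
    obtain ⟨j, hj, -, y₁, y₂, y₃, l0, l1, l2, l3, hx', e1, e2, e3, b1, b2, -⟩ :=
      exists_triple h.box hx.1 huo e
    obtain ⟨t1, t2, t3⟩ := h.triple l1 l2 (l3.trans_lt (hi_lt h.box hj)) hu huo e1 e2 e3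
      (fun z hz hz' u _ => b1 z hz hz' u trivial) (fun z hz hz' u _ => b2 z hz hz' u trivial)
    intro hb
    rcases hx' with rfl | rfl | rfl
    · obtain ⟨t, ht, ht1, ht2⟩ := h.frame.exists_ne_ne hb u (p (x - 1))
      rcases h.mem_nbrsIn hx.1 ht with h3 | ⟨h3, -⟩ | ⟨y, rfl, -, e⟩
      exacts [ht1 (ancestor_unique h.box hx.1 huo h3 e ht.2), t2 hx h3, ht2 e]
    · exact t1 hx
    · obtain ⟨t, ht, ht1, ht2⟩ := h.frame.exists_ne_ne hb u (p (x + 1))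
      rcases h.mem_nbrsIn hx.1 ht with h3 | ⟨-, h3⟩ | ⟨y, rfl, h3, -⟩
      exacts [ht1 (ancestor_unique h.box hx.1 huo h3 e ht.2), ht2 h3, t3 hx h3]
  · push Not at h0
    exact h.not_branch_of_not_hit hx h0

theorem col_eq_of_run {x y : ℕ} (hxy : x ≤ y) (hr : Run S m p x y) : c (p y) = c (p x) :=
  h.col_run hr (fun z h1 h2 => h.not_branch (hr z h1 h2)) y hxy le_rfl

end TopFrame

/-! ### Reducing the top layer to gaps and ports. -/

open SimpleGraph ThetaFrame

/-- What a theta frame looks like when its top layer is reduced to gaps: `g j` tells that the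
frame runs through the gap on the left of `w j`, with color `γ j`; the neighbor by which the
frame enters this gap from the box of `w j` is `P j 0`, and it is `P j 1` for the gap on the right
of `w j`. -/
structure GapFrame {V : Type*} (G : SimpleGraph V) (S : Set V) (a b : V) (c : V → Fin 3)
    (low top : Set V) (n : ℕ) (w : ℕ → V) (g : ℕ → Prop) (γ : ℕ → Fin 3) (P : ℕ → ℕ → V) :
    Prop where
  frame : ThetaFrame G S a b c
  sub : ∀ u ∈ S, u ∈ low ∨ (∃ j < n, u = w j) ∨ u ∈ top
  w_inj : ∀ j < n, ∀ j' < n, w j = w j' → j = j'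
  w_not_low : ∀ j < n, w j ∉ low
  w_adj : ∀ j < n, ∀ j' < n, G.Adj (w j) (w j') ↔ j' = j + 1 ∨ j = j' + 1
  low_unique : ∀ j < n, ∀ u ∈ low, ∀ v ∈ low, G.Adj (w j) u → G.Adj (w j) v → u = v
  low_sep : ∀ j, j + 1 < n → ∀ u ∈ low, ∀ v ∈ low, G.Adj (w j) u → ¬ G.Adj (w (j + 1)) v
  top_not_low : ∀ u ∈ top, u ∉ low
  top_ne_w : ∀ u ∈ top, ∀ j < n, u ≠ w j
  top_not_branch : ∀ u ∈ S, u ∈ top → ¬ (u = a ∨ u = b)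
  gap_zero : ¬ g 0
  gap_lt : ∀ j, g j → j < n
  port_inj : ∀ j < n, ∀ s ≤ 1, ∀ j' < n, ∀ s' ≤ 1, P j s = P j' s' → j = j' ∧ s = s'
  port_mem : ∀ j < n, ∀ s ≤ 1, P j s ∈ top
  port_col : ∀ j < n, ∀ s ≤ 1, g (j + s) → c (P j s) = γ (j + s)
  port_w : ∀ j < n, w j ∈ S → ∀ t, (t ∈ nbrsIn G S (w j) ∧ t ∈ top) ↔
    ∃ s ≤ 1, g (j + s) ∧ t = P j s
  port_low : ∀ u ∈ S, u ∈ low → ∀ t, (t ∈ nbrsIn G S u ∧ t ∈ top) ↔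
    ∃ j < n, w j ∉ S ∧ G.Adj (w j) u ∧ ∃ s ≤ 1, g (j + s) ∧ t = P j s
  through : ∀ j < n, w j ∉ S → (∀ v ∈ low, v ∈ S → ¬ G.Adj (w j) v) →
    (g j ↔ g (j + 1)) ∧ (g j → γ j = γ (j + 1))
  no_gap : ∀ j, j + 1 < n → w j ∈ S → w (j + 1) ∈ S → ¬ g (j + 1)

namespace TopFrame

variable {V : Type*} {G : SimpleGraph V} {S : Set V} {a b : V} {c : V → Fin 3}
  {low old : Set V} {n m : ℕ} {w p : ℕ → V} {lo hi : ℕ → ℕ}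

theorem w_mem_old (B : BoxStep G low old n m w p lo hi) {j : ℕ} (hj : j < n) : w j ∈ old :=
  (B.mem_old _).2 (Or.inr ⟨j, hj, rfl⟩)

theorem blank_gap (B : BoxStep G low old n m w p lo hi) {j : ℕ} (hj : j + 1 < n) :
    Blank G S old p (hi j) (lo (j + 1)) := by
  intro z h1 h2 u _ hu e
  have h3 := hi_lt B hj
  have h4 := B.lo_le_hi (j + 1) hj
  obtain ⟨j', hj', h5, h6⟩ := mem_box B (by omega) hu e
  rcases lt_trichotomy j' j with h7 | rfl | h7
  · have := hi_lt_lo_of_lt B h7 (by omega)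
    have := B.lo_le_hi j (by omega)
    omega
  · omega
  · rcases Nat.eq_or_lt_of_le (show j + 1 ≤ j' from h7) with rfl | h8
    · omega
    · have := hi_lt_lo_of_lt B h8 hj'
      omega

variable (h : TopFrame G S a b c low old n m w p lo hi)
include h

/-- The frame leaves a triple outwards: an outer vertex has some neighbor on the layer in `S`, and
`triple` excludes the inner one. -/
theorem triple' {j x y z : ℕ} (hj : j < n) (hxy : x < y) (hyz : y < z) (hz : z ≤ hi j)
    {u : V} (hu : u ∈ S) (huo : u ∈ old) (hxu : G.Adj (p x) u) (hyu : G.Adj (p y) u)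
    (hzu : G.Adj (p z) u) (h1 : Blank G S old p x y) (h2 : Blank G S old p y z) :
    ¬ On S m p y ∧ (On S m p x → ∃ t, t + 1 = x ∧ On S m p t) ∧
      (On S m p z → On S m p (z + 1)) := by
  obtain ⟨t1, t2, t3⟩ := h.triple hxy hyz (hz.trans_lt (hi_lt h.box hj)) hu huo hxu hyu hzu h1 h2
  refine ⟨t1, fun hx => (h.on_succ_or hx).resolve_left (t2 hx), fun hz =>
    (h.on_succ_or hz).resolve_right ?_⟩
  rintro ⟨t, e, ht⟩
  obtain rfl : t = z - 1 := by omega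
  exact t3 hz ht

/-- If `w j ∈ S`, this is the outer end of a triple. Otherwise the vertex has no ancestor in `S` and
needs both its neighbors on the layer. -/
theorem on_lo {j : ℕ} (hj : j < n) (hx : On S m p (lo j)) : ∃ t, t + 1 = lo j ∧ On S m p t := by
  have hle := h.box.lo_le_hi j hj
  by_cases hw : w j ∈ S
  · obtain ⟨j', hj', -, y₁, y₂, y₃, l0, l1, l2, l3, hx', e1, e2, e3, b1, b2, -⟩ :=
      exists_triple h.box hx.1 (w_mem_old h.box hj) (adj_lo h.box hj).1
    obtain rfl := box_unique h.box (x := lo j) hj hj' le_rfl hle (by omega) (by omega)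
    obtain rfl : lo j = y₁ := by omega
    exact (h.triple' hj l1 l2 l3 hw (w_mem_old h.box hj) e1 e2 e3
      (fun z hz hz' u _ => b1 z hz hz' u trivial)
      (fun z hz hz' u _ => b2 z hz hz' u trivial)).2.1 hx
  · refine h.on_pred_of_not_hit hx fun u hu huo e => hw ?_
    rwa [ancestor_unique h.box hx.1 huo (w_mem_old h.box hj) e (adj_lo h.box hj).1]

theorem on_hi {j : ℕ} (hj : j < n) (hx : On S m p (hi j)) : On S m p (hi j + 1) := by
  have hle := h.box.lo_le_hi j hj
  by_cases hw : w j ∈ S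
  · obtain ⟨j', hj', -, y₁, y₂, y₃, l0, l1, l2, l3, hx', e1, e2, e3, b1, b2, -⟩ :=
      exists_triple h.box hx.1 (w_mem_old h.box hj) (adj_lo h.box hj).2
    obtain rfl := box_unique h.box (x := hi j) hj hj' hle le_rfl (by omega) (by omega)
    obtain rfl : y₃ = hi j := by omega
    exact (h.triple' hj l1 l2 l3 hw (w_mem_old h.box hj) e1 e2 e3
      (fun z hz hz' u _ => b1 z hz hz' u trivial)
      (fun z hz hz' u _ => b2 z hz hz' u trivial)).2.2 hx
  · refine h.on_succ_of_not_hit hx fun u hu huo e => hw ?_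
    rwa [ancestor_unique h.box hx.1 huo (w_mem_old h.box hj) e (adj_lo h.box hj).2]

theorem run_gap {j : ℕ} (hj : j < n) (hx : On S m p (hi j)) :
    j + 1 < n ∧ Run S m p (hi j) (lo (j + 1)) := by
  have h1 := h.on_hi hj hx
  have h2 : j + 1 < n := by
    by_contra hc
    obtain rfl : j = n - 1 := by omega
    have := h.box.hi_last
    have := h1.1
    omega
  exact ⟨h2, h.run_of_on_succ (h.box.hi_lt_lo j h2) hx h1 (blank_gap h.box h2)⟩

theorem run_gap' {j : ℕ} (hj : j + 1 < n) (hx : On S m p (lo (j + 1))) :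
    Run S m p (hi j) (lo (j + 1)) := by
  obtain ⟨t, e, ht⟩ := h.on_lo hj hx
  exact h.run_of_on_pred (h.box.hi_lt_lo j hj) hx e ht (blank_gap h.box hj)

theorem on_hi_iff {j : ℕ} (hj : j < n) :
    On S m p (hi j) ↔ j + 1 < n ∧ On S m p (lo (j + 1)) := by
  constructor
  · intro hx
    obtain ⟨h1, h2⟩ := h.run_gap hj hx
    exact ⟨h1, h2 _ (h.box.hi_lt_lo j h1).le le_rfl⟩
  · rintro ⟨h1, h2⟩
    exact h.run_gap' h1 h2 _ le_rfl (h.box.hi_lt_lo j h1).le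

theorem col_hi {j : ℕ} (hj : j < n) (hx : On S m p (hi j)) :
    c (p (hi j)) = c (p (lo (j + 1))) := by
  obtain ⟨h1, h2⟩ := h.run_gap hj hx
  exact (h.col_eq_of_run (h.box.hi_lt_lo j h1).le h2).symm

/-- No vertex of the box has an ancestor in `S`, so the frame can neither turn nor stop inside it.
-/
theorem through {j : ℕ} (hj : j < n) (hw : w j ∉ S) (hv : ∀ v ∈ low, v ∈ S → ¬ G.Adj (w j) v) :
    (On S m p (lo j) ↔ On S m p (hi j)) ∧
      (On S m p (lo j) → c (p (hi j)) = c (p (lo j))) := by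
  have hle := h.box.lo_le_hi j hj
  have hb : ∀ x, lo j ≤ x → x ≤ hi j → ∀ u ∈ S, u ∈ old → ¬ G.Adj (p x) u := by
    intro x h1 h2 u hu huo e
    obtain ⟨j', hj', hu', y₁, y₂, y₃, l0, l1, l2, l3, hx', -⟩ :=
      exists_triple h.box (h2.trans_lt (hi_lt h.box hj)) huo e
    obtain rfl := box_unique h.box hj hj' h1 h2 (by omega) (by omega)
    rcases hu' with rfl | ⟨h3, h4⟩
    exacts [hw hu, hv u h3 hu h4]
  have hr : On S m p (lo j) → Run S m p (lo j) (hi j) := fun hx =>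
    h.run_right hx fun z h1 h2 => hb z h1 h2.le
  refine ⟨⟨fun hx => hr hx _ hle le_rfl, fun hx => ?_⟩, fun hx => h.col_eq_of_run hle (hr hx)⟩
  exact h.run_left hx (fun z h1 h2 => hb z h1.le h2) _ le_rfl hle

theorem no_gap {j : ℕ} (hj : j + 1 < n) (hw : w j ∈ S) (hw' : w (j + 1) ∈ S) :
    ¬ On S m p (hi j) := by
  intro hx
  have hr := (h.run_gap (by omega) hx).2
  have hlt := h.box.hi_lt_lo j hj
  exact h.not_run_of_adj hlt hr (blank_gap h.box hj) (h.not_branch hx)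
    (h.not_branch (hr _ hlt.le le_rfl)) hw (w_mem_old h.box (by omega))
    (adj_lo h.box (by omega)).2 hw' (w_mem_old h.box hj) (adj_lo h.box hj).1
    ((h.box.w_adj j (by omega) (j + 1) hj).2 (Or.inl rfl))

/-- The ports of a box. -/
theorem exists_ports {j : ℕ} (hj : j < n) :
    ∃ x y, lo j ≤ x ∧ x < y ∧ y ≤ hi j ∧ (On S m p x ↔ On S m p (lo j)) ∧
      (On S m p y ↔ On S m p (hi j)) ∧ (On S m p x → c (p x) = c (p (lo j))) ∧
      (On S m p y → c (p y) = c (p (hi j))) ∧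
      ∀ u ∈ S, u ∈ old → ∀ z, lo j ≤ z → z ≤ hi j → (On S m p z ∧ G.Adj (p z) u ↔
        (u = w j ∨ (w j ∉ S ∧ u ∈ low ∧ G.Adj (w j) u)) ∧
          ((z = x ∧ On S m p x) ∨ (z = y ∧ On S m p y))) := by
  have hle := h.box.lo_le_hi j hj
  have hwj := w_mem_old h.box hj
  have hadj := adj_lo h.box hj
  have hil := hi_lt h.box hj
  by_cases ht : ∃ v ∈ low, G.Adj (w j) v
  · obtain ⟨v, hv, ev⟩ := ht
    have hvo : v ∈ old := (h.box.mem_old _).2 (Or.inl hv)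
    obtain ⟨y₁, y₂, y₃, y₄, y₅, y₆, y₇, l1, l2, l3, l4, l5, l6, l7, l8, hq⟩ :=
      h.box.box_one j hj v hv ev
    have hw : ∀ y, (y = lo j ∨ y = y₁ ∨ y = y₂ ∨ y = y₆ ∨ y = y₇ ∨ y = hi j) →
        G.Adj (p y) (w j) := fun y hy =>
      (hq y (by omega) (by omega) _ hwj).2 (Or.inl ⟨rfl, hy⟩)
    have hv' : ∀ y, (y = y₃ ∨ y = y₄ ∨ y = y₅) → G.Adj (p y) v := fun y hy =>
      (hq y (by omega) (by omega) _ hvo).2 (Or.inr ⟨rfl, hy⟩)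
    have hblank : ∀ y y', lo j ≤ y → y' ≤ hi j →
        (∀ z, y < z → z < y' → z ≠ lo j ∧ z ≠ y₁ ∧ z ≠ y₂ ∧ z ≠ y₃ ∧ z ≠ y₄ ∧ z ≠ y₅ ∧
          z ≠ y₆ ∧ z ≠ y₇ ∧ z ≠ hi j) → Blank G S old p y y' := by
      intro y y' hy hy' hz z h3 h4 u' _ hu' e'
      have h5 := (hq z (by omega) (by omega) _ hu').1 e'
      have h6 := hz z h3 h4
      omega
    -- If `w j ∈ S`, its two triples send the frame outwards or into the stretch from `y₂` to `y₆`.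
    -- The aim is to rule out the latter, so that the ports are the ends of the box. If `v ∈ S`, a
    -- run from `y₂` to `y₃` or from `y₅` to `y₆` would join neighbors of the adjacent vertices `w
    -- j` and `v`.
    by_cases hwS : w j ∈ S
    · obtain ⟨a1, a2, a3⟩ := h.triple' hj l1 l2 (by omega) hwS hwj (hw _ (by omega))
        (hw _ (by omega)) (hw _ (by omega)) (hblank _ _ (by omega) (by omega) (by omega))
        (hblank _ _ (by omega) (by omega) (by omega))
      obtain ⟨c1, c2, c3⟩ := h.triple' hj l7 l8 le_rfl hwS hwj (hw _ (by omega))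
        (hw _ (by omega)) (hw _ (by omega)) (hblank _ _ (by omega) (by omega) (by omega))
        (hblank _ _ (by omega) (by omega) (by omega))
      have key : ¬ On S m p y₂ ∧ ¬ On S m p y₆ ∧
          (v ∈ S → ¬ On S m p y₃ ∧ ¬ On S m p y₄ ∧ ¬ On S m p y₅) := by
        by_cases hvS : v ∈ S
        · obtain ⟨b1, b2, b3⟩ := h.triple' hj l4 l5 (by omega) hvS hvo (hv' _ (by omega))
            (hv' _ (by omega)) (hv' _ (by omega)) (hblank _ _ (by omega) (by omega) (by omega))
            (hblank _ _ (by omega) (by omega) (by omega))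
          have n1 : ¬ Run S m p y₂ y₃ := fun hr =>
            h.not_run_of_adj l3 hr (hblank _ _ (by omega) (by omega) (by omega))
              (h.not_branch (hr _ le_rfl l3.le)) (h.not_branch (hr _ l3.le le_rfl)) hwS hwj
              (hw _ (by omega)) hvS hvo (hv' _ (by omega)) ev
          have n2 : ¬ Run S m p y₅ y₆ := fun hr =>
            h.not_run_of_adj l6 hr (hblank _ _ (by omega) (by omega) (by omega))
              (h.not_branch (hr _ le_rfl l6.le)) (h.not_branch (hr _ l6.le le_rfl)) hvS hvo
              (hv' _ (by omega)) hwS hwj (hw _ (by omega)) ev.symm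
          refine ⟨fun hx => n1 (h.run_of_on_succ l3 hx (a3 hx)
            (hblank _ _ (by omega) (by omega) (by omega))), fun hx => ?_, fun _ =>
            ⟨fun hx => ?_, b1, fun hx => n2 (h.run_of_on_succ l6 hx (b3 hx)
              (hblank _ _ (by omega) (by omega) (by omega)))⟩⟩
          · obtain ⟨t, e, ht⟩ := c2 hx
            exact n2 (h.run_of_on_pred l6 hx e ht (hblank _ _ (by omega) (by omega) (by omega)))
          · obtain ⟨t, e, ht⟩ := b2 hx
            exact n1 (h.run_of_on_pred l3 hx e ht (hblank _ _ (by omega) (by omega) (by omega)))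
        -- Without `v`, the stretch from `y₂` to `y₆` is a potential run between two neighbors of `w
        -- j`, whose ends would be branch vertices.
        · have hbl : Blank G S old p y₂ y₆ := by
            intro z h3 h4 u' hu' huo' e'
            rcases (hq z (by omega) (by omega) _ huo').1 e' with ⟨-, h5⟩ | ⟨rfl, -⟩
            · omega
            · exact hvS hu'
          have n1 : ¬ Run S m p y₂ y₆ := fun hr =>
            h.not_branch (hr _ le_rfl (by omega)) (h.branch_of_run (by omega) hr hbl hwS hwj
              (hw _ (by omega)) (hw _ (by omega))).1
          refine ⟨fun hx => n1 (h.run_of_on_succ (by omega) hx (a3 hx) hbl), fun hx => ?_,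
            fun hc => (hvS hc).elim⟩
          obtain ⟨t, e, ht⟩ := c2 hx
          exact n1 (h.run_of_on_pred (by omega) hx e ht hbl)
      obtain ⟨k1, k2, k3⟩ := key
      refine ⟨lo j, hi j, le_rfl, by omega, le_rfl, Iff.rfl, Iff.rfl, fun _ => rfl, fun _ => rfl,
        fun u hu huo z h1 h2 => ⟨?_, ?_⟩⟩
      · rintro ⟨hz, e⟩
        rcases (hq z h1 h2 u huo).1 e with ⟨rfl, h3⟩ | ⟨rfl, h3⟩
        · refine ⟨Or.inl rfl, ?_⟩
          rcases h3 with rfl | rfl | rfl | rfl | rfl | rfl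
          exacts [Or.inl ⟨rfl, hz⟩, (a1 hz).elim, (k1 hz).elim, (k2 hz).elim, (c1 hz).elim,
            Or.inr ⟨rfl, hz⟩]
        · obtain ⟨k3, k4, k5⟩ := k3 hu
          rcases h3 with rfl | rfl | rfl
          exacts [(k3 hz).elim, (k4 hz).elim, (k5 hz).elim]
      · rintro ⟨rfl | ⟨h3, -⟩, ⟨rfl, hz⟩ | ⟨rfl, hz⟩⟩
        exacts [⟨hz, hadj.1⟩, ⟨hz, hadj.2⟩, (h3 hwS).elim, (h3 hwS).elim]
    · have huv : ∀ u ∈ S, u ∈ old → ∀ z, lo j ≤ z → z ≤ hi j → G.Adj (p z) u →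
          u = v ∧ (z = y₃ ∨ z = y₄ ∨ z = y₅) := by
        intro u hu huo z h1 h2 e
        rcases (hq z h1 h2 u huo).1 e with ⟨rfl, h3⟩ | h3
        exacts [(hwS hu).elim, h3]
      -- Without `w j`, the frame runs freely from an end of the box to the triple of `v`, so the
      -- ports are `y₃` and `y₅`.
      by_cases hvS : v ∈ S
      · obtain ⟨b1, b2, b3⟩ := h.triple' hj l4 l5 (by omega) hvS hvo (hv' _ (by omega))
            (hv' _ (by omega)) (hv' _ (by omega)) (hblank _ _ (by omega) (by omega) (by omega))
            (hblank _ _ (by omega) (by omega) (by omega))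
        have r1 : On S m p (lo j) → Run S m p (lo j) y₃ := fun hx =>
          h.run_right hx fun z h1 h2 u hu huo e => by
            have := (huv u hu huo z h1 (by omega) e).2
            omega
        have r2 : On S m p (hi j) → Run S m p y₅ (hi j) := fun hx =>
          h.run_left hx fun z h1 h2 u hu huo e => by
            have := (huv u hu huo z (by omega) h2 e).2
            omega
        have r1' : On S m p y₃ → Run S m p (lo j) y₃ := by
          intro hx
          obtain ⟨t, e, ht⟩ := b2 hx
          exact h.run_of_on_pred (by omega) hx e ht fun z h1 h2 u hu huo e => by
            have := (huv u hu huo z h1.le (by omega) e).2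
            omega
        have r2' : On S m p y₅ → Run S m p y₅ (hi j) := by
          intro hx
          exact h.run_of_on_succ (by omega) hx (b3 hx) fun z h1 h2 u hu huo e => by
            have := (huv u hu huo z (by omega) h2.le e).2
            omega
        refine ⟨y₃, y₅, by omega, by omega, by omega,
          ⟨fun hx => r1' hx _ le_rfl (by omega), fun hx => r1 hx _ (by omega) le_rfl⟩,
          ⟨fun hx => r2' hx _ (by omega) le_rfl, fun hx => r2 hx _ le_rfl (by omega)⟩,
          fun hx => h.col_eq_of_run (by omega) (r1' hx),
          fun hx => (h.col_eq_of_run (by omega) (r2' hx)).symm,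
          fun u hu huo z h1 h2 => ⟨?_, ?_⟩⟩
        · rintro ⟨hz, e⟩
          obtain ⟨rfl, h3⟩ := huv u hu huo z h1 h2 e
          refine ⟨Or.inr ⟨hwS, hv, ev⟩, ?_⟩
          rcases h3 with rfl | rfl | rfl
          exacts [Or.inl ⟨rfl, hz⟩, (b1 hz).elim, Or.inr ⟨rfl, hz⟩]
        · rintro ⟨rfl | ⟨-, h3, h4⟩, h5⟩
          · exact (hwS hu).elim
          · obtain rfl := h.box.low_unique j hj u h3 v hv h4 ev
            rcases h5 with ⟨rfl, hz⟩ | ⟨rfl, hz⟩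
            exacts [⟨hz, hv' _ (by omega)⟩, ⟨hz, hv' _ (by omega)⟩]
      -- Nothing in `S` is attached to this box; the ends are merely convenient ports.
      · refine ⟨lo j, hi j, le_rfl, by omega, le_rfl, Iff.rfl, Iff.rfl, fun _ => rfl,
          fun _ => rfl, fun u hu huo z h1 h2 => ⟨?_, ?_⟩⟩
        · rintro ⟨hz, e⟩
          exact (hvS ((huv u hu huo z h1 h2 e).1 ▸ hu)).elim
        · rintro ⟨rfl | ⟨-, h3, h4⟩, -⟩
          · exact (hwS hu).elim
          · obtain rfl := h.box.low_unique j hj u h3 v hv h4 ev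
            exact (hvS hu).elim
  · push Not at ht
    obtain ⟨y, l1, l2, hq⟩ := h.box.box_zero j hj ht
    refine ⟨lo j, hi j, le_rfl, by omega, le_rfl, Iff.rfl, Iff.rfl, fun _ => rfl,
      fun _ => rfl, fun u hu huo z h1 h2 => ⟨?_, ?_⟩⟩
    · rintro ⟨hz, e⟩
      obtain ⟨rfl, h3⟩ := (hq z h1 h2 u huo).1 e
      refine ⟨Or.inl rfl, ?_⟩
      have hblank : ∀ y₁ y₂, lo j ≤ y₁ → y₂ ≤ hi j →
          (∀ z, y₁ < z → z < y₂ → z ≠ lo j ∧ z ≠ y ∧ z ≠ hi j) → Blank G S old p y₁ y₂ := by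
        intro y y' hy hy' hz z h3 h4 u' _ hu' e'
        have h5 := (hq z (by omega) (by omega) _ hu').1 e'
        have h6 := hz z h3 h4
        omega
      obtain ⟨a1, -, -⟩ := h.triple' hj l1 l2 le_rfl hu huo hadj.1
        ((hq y l1.le l2.le _ huo).2 ⟨rfl, by omega⟩) hadj.2
        (hblank _ _ (by omega) (by omega) (by omega))
        (hblank _ _ (by omega) (by omega) (by omega))
      rcases h3 with rfl | rfl | rfl
      exacts [Or.inl ⟨rfl, hz⟩, (a1 hz).elim, Or.inr ⟨rfl, hz⟩]
    · rintro ⟨rfl | ⟨-, h3, h4⟩, ⟨rfl, hz⟩ | ⟨rfl, hz⟩⟩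
      exacts [⟨hz, hadj.1⟩, ⟨hz, hadj.2⟩, (ht u h3 h4).elim, (ht u h3 h4).elim]

theorem exists_gapFrame : ∃ top g γ P, GapFrame G S a b c low top n w g γ P := by
  have hports := fun j (hj : j < n) => h.exists_ports hj
  choose! X Y hX hXY hY hXlo hYhi hcX hcY hadj using hports
  -- An occupied first vertex of a box forces the whole gap on its left to be occupied. The conjunct
  -- `j < n` makes `g n` false: nothing lies right of the last box.
  let g : ℕ → Prop := fun j => j < n ∧ On S m p (lo j)
  let Q : ℕ → ℕ → ℕ := fun j s => if s = 0 then X j else Y j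
  have hQ0 : ∀ j, Q j 0 = X j := fun j => rfl
  have hQ1 : ∀ j, Q j 1 = Y j := fun j => rfl
  have hQ : ∀ j < n, ∀ s ≤ 1, lo j ≤ Q j s ∧ Q j s ≤ hi j := by
    intro j hj s hs
    have := hX j hj
    have := hXY j hj
    have := hY j hj
    rcases Nat.le_one_iff_eq_zero_or_eq_one.1 hs with rfl | rfl
    · rw [hQ0]; omega
    · rw [hQ1]; omega
  have hQm : ∀ j < n, ∀ s ≤ 1, Q j s < m := fun j hj s hs =>
    (hQ j hj s hs).2.trans_lt (hi_lt h.box hj)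
  have hgQ : ∀ j < n, ∀ s ≤ 1, g (j + s) ↔ On S m p (Q j s) := by
    intro j hj s hs
    rcases Nat.le_one_iff_eq_zero_or_eq_one.1 hs with rfl | rfl
    · rw [hQ0, hXlo j hj]
      exact ⟨fun h => h.2, fun h => ⟨hj, h⟩⟩
    · rw [hQ1, hYhi j hj, h.on_hi_iff hj]
  have hadj' : ∀ j < n, ∀ u ∈ S, u ∈ old → ∀ z, lo j ≤ z → z ≤ hi j →
      (On S m p z ∧ G.Adj (p z) u ↔ (u = w j ∨ (w j ∉ S ∧ u ∈ low ∧ G.Adj (w j) u)) ∧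
        ∃ s ≤ 1, g (j + s) ∧ z = Q j s) := by
    intro j hj u hu huo z h1 h2
    rw [hadj j hj u hu huo z h1 h2]
    refine and_congr_right fun _ => ⟨?_, ?_⟩
    · rintro (⟨rfl, hz⟩ | ⟨rfl, hz⟩)
      · exact ⟨0, by omega, (hgQ j hj 0 (by omega)).2 hz, rfl⟩
      · exact ⟨1, le_rfl, (hgQ j hj 1 (by omega)).2 hz, rfl⟩
    · rintro ⟨s, hs, hg, rfl⟩
      have hon := (hgQ j hj s hs).1 hg
      rcases Nat.le_one_iff_eq_zero_or_eq_one.1 hs with rfl | rfl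
      exacts [Or.inl ⟨rfl, hon⟩, Or.inr ⟨rfl, hon⟩]
  have hport : ∀ u ∈ S, u ∈ old → ∀ t, (t ∈ nbrsIn G S u ∧ t ∈ p '' Set.Iio m) ↔
      ∃ j < n, (u = w j ∨ (w j ∉ S ∧ u ∈ low ∧ G.Adj (w j) u)) ∧
        ∃ s ≤ 1, g (j + s) ∧ t = p (Q j s) := by
    intro u hu huo t
    constructor
    · rintro ⟨⟨htS, e⟩, z, hz, rfl⟩
      obtain ⟨j, hj, h1, h2⟩ := mem_box h.box hz huo e.symm
      obtain ⟨h3, s, hs, hg, rfl⟩ := (hadj' j hj u hu huo z h1 h2).1 ⟨⟨hz, htS⟩, e.symm⟩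
      exact ⟨j, hj, h3, s, hs, hg, rfl⟩
    · rintro ⟨j, hj, h3, s, hs, hg, rfl⟩
      obtain ⟨h1, h2⟩ := hQ j hj s hs
      obtain ⟨h4, h5⟩ := (hadj' j hj u hu huo _ h1 h2).2 ⟨h3, s, hs, hg, rfl⟩
      exact ⟨⟨h4.2, h5.symm⟩, _, h4.1, rfl⟩
  refine ⟨p '' Set.Iio m, g, fun j => c (p (lo j)), fun j s => p (Q j s), ?_⟩
  exact
    { frame := h.frame
      sub := by
        intro u hu
        rcases h.sub u hu with h1 | ⟨x, hx, rfl⟩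
        · exact ((h.box.mem_old u).1 h1).imp id Or.inl
        · exact Or.inr (Or.inr ⟨x, hx, rfl⟩)
      w_inj := h.box.w_inj
      w_not_low := h.box.w_not_low
      w_adj := h.box.w_adj
      low_unique := h.box.low_unique
      low_sep := h.box.low_sep
      top_not_low := by
        rintro _ ⟨x, hx, rfl⟩ hl
        exact h.box.p_not_old x hx ((h.box.mem_old _).2 (Or.inl hl))
      top_ne_w := by
        rintro _ ⟨x, hx, rfl⟩ j hj e
        exact h.p_ne_old hx (w_mem_old h.box hj) e
      top_not_branch := by
        rintro _ hu ⟨x, hx, rfl⟩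
        exact h.not_branch ⟨hx, hu⟩
      gap_zero := by
        rintro ⟨h0, hx⟩
        obtain ⟨t, e, -⟩ := h.on_lo h0 hx
        rw [h.box.lo_zero] at e
        omega
      gap_lt := fun j hj => hj.1
      port_inj := by
        intro j hj s hs j' hj' s' hs' e
        have e' := h.box.p_inj _ (hQm j hj s hs) _ (hQm j' hj' s' hs') e
        obtain ⟨h1, h2⟩ := hQ j hj s hs
        obtain ⟨h3, h4⟩ := hQ j' hj' s' hs'
        obtain rfl := box_unique h.box hj hj' h1 h2 (by omega) (by omega)
        refine ⟨rfl, ?_⟩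
        have h5 := hXY j hj
        rcases Nat.le_one_iff_eq_zero_or_eq_one.1 hs with rfl | rfl <;>
          rcases Nat.le_one_iff_eq_zero_or_eq_one.1 hs' with rfl | rfl
        · rfl
        · rw [hQ0, hQ1] at e'; omega
        · rw [hQ0, hQ1] at e'; omega
        · rfl
      port_mem := fun j hj s hs => ⟨_, hQm j hj s hs, rfl⟩
      port_col := by
        intro j hj s hs hg
        have hon := (hgQ j hj s hs).1 hg
        rcases Nat.le_one_iff_eq_zero_or_eq_one.1 hs with rfl | rfl
        · exact hcX j hj hon
        · exact (hcY j hj hon).trans (h.col_hi hj ((hYhi j hj).1 hon))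
      port_w := by
        intro j hj hw t
        rw [hport _ hw (w_mem_old h.box hj)]
        constructor
        · rintro ⟨j', hj', h1 | ⟨-, h1, -⟩, h2⟩
          · obtain rfl := h.box.w_inj j hj j' hj' h1
            exact h2
          · exact (h.box.w_not_low j hj h1).elim
        · exact fun h1 => ⟨j, hj, Or.inl rfl, h1⟩
      port_low := by
        intro u hu hl t
        rw [hport _ hu ((h.box.mem_old u).2 (Or.inl hl))]
        constructor
        · rintro ⟨j, hj, rfl | ⟨h1, -, h2⟩, h3⟩
          · exact (h.box.w_not_low j hj hl).elim
          · exact ⟨j, hj, h1, h2, h3⟩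
        · rintro ⟨j, hj, h1, h2, h3⟩
          exact ⟨j, hj, Or.inr ⟨h1, hl, h2⟩, h3⟩
      through := by
        intro j hj hw hv
        obtain ⟨h1, h2⟩ := h.through hj hw hv
        have h3 := h.on_hi_iff hj
        refine ⟨⟨fun hg => h3.1 (h1.1 hg.2), fun hg => ⟨hj, h1.2 (h3.2 hg)⟩⟩, fun hg => ?_⟩
        rw [← h.col_hi hj (h1.1 hg.2)]
        exact (h2 hg.2).symm
      no_gap := fun j hj hw hw' hg => h.no_gap hj hw hw' ((h.on_hi_iff (by omega)).2 hg) }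

end TopFrame

/-! ### Pushing a frame down one layer. -/

namespace GapFrame

variable {V : Type*} {G : SimpleGraph V} {S : Set V} {a b : V} {c : V → Fin 3}
  {low top : Set V} {n : ℕ} {w : ℕ → V} {g : ℕ → Prop} {γ : ℕ → Fin 3} {P : ℕ → ℕ → V}

/-- Applied to a relation between old and new neighbors of a vertex, in order to transport degrees
and colors. -/
theorem exists_bijOn {A B : Set V} {R : V → V → Prop} (hB : ∀ z, z ∈ B ↔ ∃ y ∈ A, R y z)
    (ht : ∀ y ∈ A, ∃ z, R y z) (hf : ∀ y z z', R y z → R y z' → z = z')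
    (hi : ∀ y ∈ A, ∀ y' ∈ A, ∀ z, R y z → R y' z → y = y') :
    ∃ f : V → V, Set.BijOn f A B ∧ ∀ y ∈ A, R y (f y) := by
  choose! f hR using ht
  refine ⟨f, ⟨fun y hy => (hB _).2 ⟨y, hy, hR y hy⟩, fun y hy y' hy' e =>
    hi y hy y' hy' (f y) (hR y hy) (e ▸ hR y' hy'), fun z hz => ?_⟩, hR⟩
  obtain ⟨y, hy, h1⟩ := (hB z).1 hz
  exact ⟨y, hy, hf y _ _ (hR y hy) h1⟩

theorem encard_eq {A B : Set V} {f : V → V} (hf : Set.BijOn f A B) : B.encard = A.encard := by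
  rw [← hf.image_eq, hf.injOn.encard_image]

theorem bijOn_col {A B : Set V} {f : V → V} {c c' : V → Fin 3} (hf : Set.BijOn f A B)
    (hc : Set.BijOn c A Set.univ) (he : ∀ y ∈ A, c' (f y) = c y) :
    Set.BijOn c' B Set.univ := by
  refine ⟨fun _ _ => trivial, ?_, fun k _ => ?_⟩
  · intro z hz z' hz' e
    obtain ⟨y, hy, rfl⟩ := hf.surjOn hz
    obtain ⟨y', hy', rfl⟩ := hf.surjOn hz'
    rw [he y hy, he y' hy'] at e
    rw [hc.injOn hy hy' e]
  · obtain ⟨y, hy, rfl⟩ := hc.surjOn (Set.mem_univ k)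
    exact ⟨f y, hf.mapsTo hy, he y hy⟩

/-- The frame enters the box of `w j` on both sides and meets there twice the ancestor `u` of
`w j`. -/
def Dbl (G : SimpleGraph V) (S low : Set V) (n : ℕ) (w : ℕ → V) (g : ℕ → Prop) (j : ℕ) (u : V) :
    Prop :=
  j < n ∧ w j ∉ S ∧ u ∈ low ∧ u ∈ S ∧ G.Adj (w j) u ∧ g j ∧ g (j + 1)

/-- The vertices of the frame obtained by pushing the frame down from the top layer. -/
def newSet (G : SimpleGraph V) (S : Set V) (a b : V) (low : Set V) (n : ℕ) (w : ℕ → V)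
    (g : ℕ → Prop) : Set V :=
  {u | (u ∈ low ∧ u ∈ S ∧ ((∃ j, Dbl G S low n w g j u) → u = a ∨ u = b)) ∨
    ∃ j < n, u = w j ∧ (w j ∈ S ∨ g j ∨ g (j + 1))}

open scoped Classical in
/-- The coloring of the frame obtained by pushing the frame down from the top layer. -/
noncomputable def newCol (G : SimpleGraph V) (S : Set V) (c : V → Fin 3) (low : Set V) (n : ℕ)
    (w : ℕ → V) (g : ℕ → Prop) (γ : ℕ → Fin 3) (P : ℕ → ℕ → V) (u : V) : Fin 3 :=
  if ∃ j < n, u = w j then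
    if u ∈ S then c u
    else Classical.epsilon fun k => ∃ j < n, u = w j ∧ k = if g j then γ j else γ (j + 1)
  else if ∃ j, Dbl G S low n w g j u then
    Classical.epsilon fun k => ∃ j, Dbl G S low n w g j u ∧
      ∃ t ∈ G.nbrsIn S u, t ≠ P j 0 ∧ t ≠ P j 1 ∧ k = c t
  else c u

/-- The branch vertex `u` becomes `u'` when the frame is pushed down. -/
def NewBranch (G : SimpleGraph V) (S low : Set V) (n : ℕ) (w : ℕ → V) (g : ℕ → Prop)
    (u u' : V) : Prop :=
  ((∀ j, ¬ Dbl G S low n w g j u) ∧ u' = u) ∨ ∃ j, Dbl G S low n w g j u ∧ u' = w j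

/-- The neighbors of `w j` in the frame on the left (`s = 0`) and on the right (`s = 1`). -/
def Side (S : Set V) (n : ℕ) (w : ℕ → V) (g : ℕ → Prop) (P : ℕ → ℕ → V) (j s : ℕ) (t : V) :
    Prop :=
  (∃ j' < n, j' + 1 = j + 2 * s ∧ w j' ∈ S ∧ t = w j') ∨ (g (j + s) ∧ t = P j s)

theorem exists_newBranch (G : SimpleGraph V) (S low : Set V) (n : ℕ) (w : ℕ → V) (g : ℕ → Prop)
    (u : V) : ∃ u', NewBranch G S low n w g u u' := by
  by_cases hd : ∃ j, Dbl G S low n w g j u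
  · obtain ⟨j, hj⟩ := hd
    exact ⟨w j, Or.inr ⟨j, hj, rfl⟩⟩
  · push Not at hd
    exact ⟨u, Or.inl ⟨hd, rfl⟩⟩

variable (h : GapFrame G S a b c low top n w g γ P)
include h

theorem ports_ne {j : ℕ} (hj : j < n) : P j 0 ≠ P j 1 := fun e =>
  absurd (h.port_inj j hj 0 (by omega) j hj 1 le_rfl e).2 (by omega)

theorem port_nbr {j s : ℕ} {u : V} (hd : Dbl G S low n w g j u) (hs : s ≤ 1) :
    P j s ∈ G.nbrsIn S u := by
  obtain ⟨hj, hw, hl, hu, e, g0, g1⟩ := hd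
  refine ((h.port_low u hu hl _).2 ⟨j, hj, hw, e, s, hs, ?_, rfl⟩).1
  rcases Nat.le_one_iff_eq_zero_or_eq_one.1 hs with rfl | rfl
  exacts [g0, g1]

theorem no_gap' {j j' s : ℕ} (hj : j < n) (hj' : j' < n) (e : j' + 1 = j + 2 * s) (hs : s ≤ 1)
    (hw : w j ∈ S) (hw' : w j' ∈ S) : ¬ g (j + s) := by
  rcases Nat.le_one_iff_eq_zero_or_eq_one.1 hs with rfl | rfl
  · obtain rfl : j = j' + 1 := by omega
    exact h.no_gap j' hj hw' hw
  · obtain rfl : j' = j + 1 := by omega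
    exact h.no_gap j hj' hw hw'

theorem low_sep' {j j' s : ℕ} (hj : j < n) (hj' : j' < n) (e : j' + 1 = j + 2 * s) (hs : s ≤ 1)
    {u v : V} (hu : u ∈ low) (hv : v ∈ low) (eu : G.Adj (w j) u) : ¬ G.Adj (w j') v := by
  intro ev
  rcases Nat.le_one_iff_eq_zero_or_eq_one.1 hs with rfl | rfl
  · obtain rfl : j = j' + 1 := by omega
    exact h.low_sep j' hj v hv u hu ev eu
  · obtain rfl : j' = j + 1 := by omega
    exact h.low_sep j hj' u hu v hv eu ev

theorem adj_w {j j' s : ℕ} (hj : j < n) (hj' : j' < n) (e : j' + 1 = j + 2 * s) (hs : s ≤ 1) :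
    G.Adj (w j) (w j') := (h.w_adj j hj j' hj').2 (by omega)

theorem exists_side_of_adj {j j' : ℕ} (hj : j < n) (hj' : j' < n) (e : G.Adj (w j) (w j')) :
    ∃ s ≤ 1, j' + 1 = j + 2 * s := by
  rcases (h.w_adj j hj j' hj').1 e with e | e
  exacts [⟨1, le_rfl, by omega⟩, ⟨0, by omega, by omega⟩]

/-- A gap has a box on both sides. -/
theorem exists_next {j s : ℕ} (hj : j < n) (hs : s ≤ 1) (hg : g (j + s)) :
    ∃ j' < n, j' + 1 = j + 2 * s ∧ (g j' ∨ g (j' + 1)) := by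
  rcases Nat.le_one_iff_eq_zero_or_eq_one.1 hs with rfl | rfl
  · cases j with
    | zero => exact (h.gap_zero hg).elim
    | succ j => exact ⟨j, by omega, by omega, Or.inr hg⟩
  · exact ⟨j + 1, h.gap_lt _ hg, by omega, Or.inl hg⟩

theorem side_of_nbr {j : ℕ} (hj : j < n) (hw : w j ∈ S) {t : V} (ht : t ∈ G.nbrsIn S (w j)) :
    t ∈ low ∨ ∃ s ≤ 1, Side S n w g P j s t := by
  rcases h.sub t ht.1 with h1 | ⟨j', hj', rfl⟩ | h1
  · exact Or.inl h1
  · obtain ⟨s, hs, e⟩ := h.exists_side_of_adj hj hj' ht.2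
    exact Or.inr ⟨s, hs, Or.inl ⟨j', hj', e, ht.1, rfl⟩⟩
  · obtain ⟨s, hs, hg, rfl⟩ := (h.port_w j hj hw t).1 ⟨ht, h1⟩
    exact Or.inr ⟨s, hs, Or.inr ⟨hg, rfl⟩⟩

theorem side_unique {j s : ℕ} (hj : j < n) (hw : w j ∈ S) (hs : s ≤ 1) {t t' : V}
    (ht : Side S n w g P j s t) (ht' : Side S n w g P j s t') : t = t' := by
  rcases ht with ⟨j₁, h1, h2, h3, rfl⟩ | ⟨h1, rfl⟩ <;>
    rcases ht' with ⟨j₁', h1', h2', h3', rfl⟩ | ⟨h1', rfl⟩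
  · obtain rfl : j₁ = j₁' := by omega
    rfl
  · exact (h.no_gap' hj h1 h2 hs hw h3 h1').elim
  · exact (h.no_gap' hj h1' h2' hs hw h3' h1).elim
  · rfl

/-- Each of the two sides supplies at most one neighbor, and a branch vertex has three. -/
theorem exists_low_nbr_of_branch {j : ℕ} (hj : j < n) (hb : w j = a ∨ w j = b) :
    ∃ v ∈ low, v ∈ S ∧ G.Adj (w j) v := by
  have hw : w j ∈ S := by
    rcases hb with e | e
    · rw [e]; exact h.frame.left_mem
    · rw [e]; exact h.frame.right_mem
  by_contra! hc
  have key : ∀ t ∈ G.nbrsIn S (w j), ∃ s ≤ 1, Side S n w g P j s t := fun t ht =>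
    (h.side_of_nbr hj hw ht).resolve_left fun hl => hc t hl ht.1 ht.2
  obtain ⟨t, ht, -⟩ := h.frame.exists_ne hw a
  obtain ⟨t', ht', e1⟩ := h.frame.exists_ne hw t
  obtain ⟨r, hr, e2, e3⟩ := h.frame.exists_ne_ne hb t t'
  obtain ⟨s1, hs1, h1⟩ := key t ht
  obtain ⟨s2, hs2, h2⟩ := key t' ht'
  obtain ⟨s3, hs3, h3⟩ := key r hr
  have n1 : s1 ≠ s2 := by rintro rfl; exact e1 (h.side_unique hj hw hs1 h2 h1)
  have n2 : s1 ≠ s3 := by rintro rfl; exact e2 (h.side_unique hj hw hs1 h3 h1)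
  have n3 : s2 ≠ s3 := by rintro rfl; exact e3 (h.side_unique hj hw hs2 h3 h2)
  omega

theorem exists_low_nbr {j : ℕ} (hj : j < n) (hw : w j ∉ S) (h1 : g j ∨ g (j + 1))
    (h2 : ¬ (g j ∧ g (j + 1))) : ∃ v ∈ low, v ∈ S ∧ G.Adj (w j) v := by
  by_contra! hc
  have := (h.through j hj hw hc).1
  tauto

/-- If the gap between them is unused, `w j'` is inserted because of its other gap alone, so it has
an ancestor in `S`. Then `w j` has no ancestor by `low_sep` and no neighbor on side `s`, which
leaves it at most one neighbor. -/
theorem gap_of_new_aux {j j' s : ℕ} (hj : j < n) (hj' : j' < n) (e : j' + 1 = j + 2 * s)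
    (hs : s ≤ 1) (hw : w j ∈ S) (hw' : w j' ∉ S) (hg : g j' ∨ g (j' + 1)) : g (j + s) := by
  by_contra hng
  have hnot : ¬ (g j' ∧ g (j' + 1)) := by
    rintro ⟨h1, h2⟩
    rcases Nat.le_one_iff_eq_zero_or_eq_one.1 hs with rfl | rfl
    · exact hng (by rwa [show j + 0 = j' + 1 by omega])
    · exact hng (by rwa [show j + 1 = j' by omega])
  obtain ⟨v, hv, -, ev⟩ := h.exists_low_nbr hj' hw' hg hnot
  have key : ∀ t ∈ G.nbrsIn S (w j), Side S n w g P j (1 - s) t := by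
    intro t ht
    rcases h.side_of_nbr hj hw ht with hl | ⟨r, hr, h1⟩
    · exact (h.low_sep' hj hj' e hs hl hv ht.2 ev).elim
    · by_cases hrs : r = s
      · subst hrs
        rcases h1 with ⟨j₁, -, h2, h3, -⟩ | ⟨h1, -⟩
        · obtain rfl : j₁ = j' := by omega
          exact (hw' h3).elim
        · exact (hng h1).elim
      · rwa [show 1 - s = r by omega]
  obtain ⟨t, ht, -⟩ := h.frame.exists_ne hw a
  obtain ⟨t', ht', e1⟩ := h.frame.exists_ne hw t
  exact e1 (h.side_unique hj hw (by omega) (key t' ht') (key t ht))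

/-- Pushing down creates no accidental edge in the layer of `w`: each new edge there is an old one
or stands for a used gap. -/
theorem gap_of_new {j j' s : ℕ} (hj : j < n) (hj' : j' < n) (e : j' + 1 = j + 2 * s)
    (hs : s ≤ 1) (hN : w j ∈ S ∨ g j ∨ g (j + 1)) (hN' : w j' ∈ S ∨ g j' ∨ g (j' + 1)) :
    (w j ∈ S ∧ w j' ∈ S) ∨ g (j + s) := by
  by_cases hw : w j ∈ S <;> by_cases hw' : w j' ∈ S
  · exact Or.inl ⟨hw, hw'⟩
  · exact Or.inr (h.gap_of_new_aux hj hj' e hs hw hw' (hN'.resolve_left hw'))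
  · have := h.gap_of_new_aux (s := 1 - s) hj' hj (by omega) (by omega) hw' hw (hN.resolve_left hw)
    rw [show j' + (1 - s) = j + s by omega] at this
    exact Or.inr this
  · right
    by_contra hng
    have hs' := Nat.le_one_iff_eq_zero_or_eq_one.1 hs
    obtain ⟨v, hv, -, ev⟩ := h.exists_low_nbr hj hw (hN.resolve_left hw) (by
      rcases hs' with rfl | rfl
      exacts [fun hc => hng hc.1, fun hc => hng hc.2])
    obtain ⟨v', hv', -, ev'⟩ := h.exists_low_nbr hj' hw' (hN'.resolve_left hw') (by
      rintro ⟨h1, h2⟩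
      rcases hs' with rfl | rfl
      · exact hng (by rwa [show j + 0 = j' + 1 by omega])
      · exact hng (by rwa [show j + 1 = j' by omega]))
    exact h.low_sep' hj hj' e hs hv hv' ev ev'

/-- The two ports exhaust the neighbors of a doubly met vertex of degree two, so dropping it
disconnects nothing else. -/
theorem mem_top_of_dbl {j : ℕ} {u t : V} (hd : Dbl G S low n w g j u) (hb : ¬ (u = a ∨ u = b))
    (ht : t ∈ G.nbrsIn S u) : t ∈ top := by
  rcases h.frame.eq_or_eq hd.2.2.2.1 hb (h.port_nbr hd (s := 0) (by omega))
    (h.port_nbr hd le_rfl) (h.ports_ne hd.1) ht with rfl | rfl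
  exacts [h.port_mem j hd.1 0 (by omega), h.port_mem j hd.1 1 le_rfl]

/-- The ports use two of the three colors at a branch vertex, and one is left for the third
neighbor. -/
theorem eq_of_dbl {j : ℕ} {u z t : V} (hd : Dbl G S low n w g j u) (hb : u = a ∨ u = b)
    (hz : z ∈ G.nbrsIn S u) (ht : t ∈ G.nbrsIn S u) (z0 : z ≠ P j 0) (z1 : z ≠ P j 1)
    (t0 : t ≠ P j 0) (t1 : t ≠ P j 1) : t = z := by
  have hi := (h.frame.bij hb).injOn
  have p0 := h.port_nbr hd (s := 0) (by omega)
  have p1 := h.port_nbr hd (s := 1) le_rfl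
  by_contra hne
  have e1 := hi.ne p0 p1 (h.ports_ne hd.1)
  have e2 := hi.ne hz p0 z0
  have e3 := hi.ne hz p1 z1
  have e4 := hi.ne ht p0 t0
  have e5 := hi.ne ht p1 t1
  have e6 := hi.ne ht hz hne
  omega

/-- Two boxes would give four ports, but a branch vertex has three neighbors. -/
theorem dbl_unique {j j' : ℕ} {u : V} (hd : Dbl G S low n w g j u)
    (hd' : Dbl G S low n w g j' u) (hb : u = a ∨ u = b) : j = j' := by
  by_contra hne
  have hP : ∀ s ≤ 1, ∀ s' ≤ 1, P j' s' ≠ P j s := fun s hs s' hs' e =>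
    hne (h.port_inj j' hd'.1 s' hs' j hd.1 s hs e).1.symm
  exact h.ports_ne hd'.1 (h.eq_of_dbl hd hb (h.port_nbr hd' le_rfl)
    (h.port_nbr hd' (s := 0) (by omega)) (hP 0 (by omega) 1 le_rfl) (hP 1 le_rfl 1 le_rfl)
    (hP 0 (by omega) 0 (by omega)) (hP 1 le_rfl 0 (by omega)))

theorem not_mem_top_w {j : ℕ} (hj : j < n) : w j ∉ top := fun hc => h.top_ne_w _ hc j hj rfl

theorem not_mem_top_low {u : V} (hu : u ∈ low) : u ∉ top := fun hc => h.top_not_low u hc hu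

theorem mem_newSet_w {j : ℕ} (hj : j < n) :
    w j ∈ newSet G S a b low n w g ↔ w j ∈ S ∨ g j ∨ g (j + 1) := by
  constructor
  · rintro (⟨hl, -⟩ | ⟨j', hj', e, h1⟩)
    · exact (h.w_not_low j hj hl).elim
    · obtain rfl := h.w_inj j hj j' hj' e
      exact h1
  · exact fun h1 => Or.inr ⟨j, hj, rfl, h1⟩

theorem mem_newSet_low {u : V} (hu : u ∈ low) : u ∈ newSet G S a b low n w g ↔
    u ∈ S ∧ ((∃ j, Dbl G S low n w g j u) → u = a ∨ u = b) := by
  constructor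
  · rintro (⟨-, h1⟩ | ⟨j', hj', rfl, -⟩)
    · exact h1
    · exact (h.w_not_low j' hj' hu).elim
  · exact fun h1 => Or.inl ⟨hu, h1⟩

/-- A vertex of the frame outside the top layer which has a neighbor in the frame outside the top
layer is kept. -/
theorem mem_newSet_of_nbr {u y : V} (hu : u ∉ top) (huS : u ∈ S) (hy : y ∈ S) (hyt : y ∉ top)
    (e : G.Adj u y) : y ∈ newSet G S a b low n w g := by
  rcases h.sub y hy with h1 | ⟨j, hj, rfl⟩ | h1
  · refine (h.mem_newSet_low h1).2 ⟨hy, ?_⟩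
    rintro ⟨j, hd⟩
    by_contra hb
    exact hu (h.mem_top_of_dbl hd hb ⟨huS, e.symm⟩)
  · exact (h.mem_newSet_w hj).2 (Or.inl hy)
  · exact (hyt h1).elim

theorem mem_nbrsIn_low {u : V} (hu : u ∈ low) (huS : u ∈ S) (z : V) :
    z ∈ G.nbrsIn (newSet G S a b low n w g) u ↔ ∃ y ∈ G.nbrsIn S u, (y ∉ top ∧ z = y) ∨
      ∃ j < n, w j ∉ S ∧ G.Adj (w j) u ∧ ∃ s ≤ 1, g (j + s) ∧ y = P j s ∧ z = w j := by
  constructor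
  · rintro ⟨⟨h1, h2, -⟩ | ⟨j, hj, rfl, h1⟩, e⟩
    · exact ⟨z, ⟨h2, e⟩, Or.inl ⟨h.not_mem_top_low h1, rfl⟩⟩
    · by_cases hw : w j ∈ S
      · exact ⟨w j, ⟨hw, e⟩, Or.inl ⟨h.not_mem_top_w hj, rfl⟩⟩
      · obtain ⟨s, hs, hg⟩ : ∃ s ≤ 1, g (j + s) := by
          rcases h1.resolve_left hw with h2 | h2
          exacts [⟨0, by omega, h2⟩, ⟨1, le_rfl, h2⟩]
        exact ⟨P j s, ((h.port_low u huS hu _).2 ⟨j, hj, hw, e.symm, s, hs, hg, rfl⟩).1,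
          Or.inr ⟨j, hj, hw, e.symm, s, hs, hg, rfl, rfl⟩⟩
  · rintro ⟨y, hy, ⟨hyt, rfl⟩ | ⟨j, hj, hw, e, s, hs, hg, rfl, rfl⟩⟩
    · exact ⟨h.mem_newSet_of_nbr (h.not_mem_top_low hu) huS hy.1 hyt hy.2, hy.2⟩
    · refine ⟨(h.mem_newSet_w hj).2 (Or.inr ?_), e.symm⟩
      rcases Nat.le_one_iff_eq_zero_or_eq_one.1 hs with rfl | rfl
      exacts [Or.inl hg, Or.inr hg]

theorem exists_image_low {u y : V} (hu : u ∈ low) (huS : u ∈ S) (hy : y ∈ G.nbrsIn S u) :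
    ∃ z, (y ∉ top ∧ z = y) ∨
      ∃ j < n, w j ∉ S ∧ G.Adj (w j) u ∧ ∃ s ≤ 1, g (j + s) ∧ y = P j s ∧ z = w j := by
  by_cases hyt : y ∈ top
  · obtain ⟨j, hj, hw, e, s, hs, hg, rfl⟩ := (h.port_low u huS hu y).1 ⟨hy, hyt⟩
    exact ⟨w j, Or.inr ⟨j, hj, hw, e, s, hs, hg, rfl, rfl⟩⟩
  · exact ⟨y, Or.inl ⟨hyt, rfl⟩⟩

theorem image_low_unique {u y z z' : V}
    (h1 : (y ∉ top ∧ z = y) ∨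
      ∃ j < n, w j ∉ S ∧ G.Adj (w j) u ∧ ∃ s ≤ 1, g (j + s) ∧ y = P j s ∧ z = w j)
    (h2 : (y ∉ top ∧ z' = y) ∨
      ∃ j < n, w j ∉ S ∧ G.Adj (w j) u ∧ ∃ s ≤ 1, g (j + s) ∧ y = P j s ∧ z' = w j) : z = z' := by
  rcases h1 with ⟨h1, rfl⟩ | ⟨j, hj, hw, e, s, hs, hg, rfl, rfl⟩ <;>
    rcases h2 with ⟨h2, rfl⟩ | ⟨j', hj', hw', e', s', hs', hg', e2, rfl⟩
  · rfl
  · exact (h1 (e2 ▸ h.port_mem j' hj' s' hs')).elim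
  · exact (h2 (h.port_mem j hj s hs)).elim
  · rw [(h.port_inj j hj s hs j' hj' s' hs' e2).1]

/-- A port in the box of `w j` is replaced by `w j`. Two neighbors are merged only when both ports
of one box are adjacent to `u`, which is the excluded double case. -/
theorem exists_bijOn_low {u : V} (hu : u ∈ low) (huS : u ∈ S)
    (hd : ∀ j, ¬ Dbl G S low n w g j u) :
    ∃ f : V → V, Set.BijOn f (G.nbrsIn S u) (G.nbrsIn (newSet G S a b low n w g) u) ∧
      ∀ y ∈ G.nbrsIn S u, (y ∉ top ∧ f y = y) ∨
      ∃ j < n, w j ∉ S ∧ G.Adj (w j) u ∧ ∃ s ≤ 1, g (j + s) ∧ y = P j s ∧ f y = w j := by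
  refine exists_bijOn (R := fun y z => (y ∉ top ∧ z = y) ∨
      ∃ j < n, w j ∉ S ∧ G.Adj (w j) u ∧ ∃ s ≤ 1, g (j + s) ∧ y = P j s ∧ z = w j)
    (h.mem_nbrsIn_low hu huS) (fun y hy => h.exists_image_low hu huS hy)
    (fun y z z' h1 h2 => h.image_low_unique h1 h2) ?_
  rintro y hy y' hy' z h1 h2
  rcases h1 with ⟨h1, rfl⟩ | ⟨j, hj, hw, e, s, hs, hg, rfl, rfl⟩ <;>
    rcases h2 with ⟨h2, e2⟩ | ⟨j', hj', hw', e', s', hs', hg', rfl, e2⟩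
  · exact e2
  · exact (hw' (e2 ▸ hy.1)).elim
  · exact (hw (e2 ▸ hy'.1)).elim
  · obtain rfl := h.w_inj j hj j' hj' e2
    rcases Nat.le_one_iff_eq_zero_or_eq_one.1 hs with rfl | rfl <;>
      rcases Nat.le_one_iff_eq_zero_or_eq_one.1 hs' with rfl | rfl
    · rfl
    · exact (hd j ⟨hj, hw, hu, huS, e, hg, hg'⟩).elim
    · exact (hd j ⟨hj, hw, hu, huS, e, hg', hg⟩).elim
    · rfl

/-- A port is replaced by the next vertex of the layer on the same side. That vertex was not a
neighbor in `S` before, because a gap between two vertices of `S` is unused. -/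
theorem exists_bijOn_w {j : ℕ} (hj : j < n) (hw : w j ∈ S) :
    ∃ f : V → V, Set.BijOn f (G.nbrsIn S (w j)) (G.nbrsIn (newSet G S a b low n w g) (w j)) ∧
      ∀ y ∈ G.nbrsIn S (w j), (y ∉ top ∧ f y = y) ∨
      ∃ s ≤ 1, g (j + s) ∧ y = P j s ∧ ∃ j' < n, j' + 1 = j + 2 * s ∧ f y = w j' := by
  refine exists_bijOn (R := fun y z => (y ∉ top ∧ z = y) ∨
      ∃ s ≤ 1, g (j + s) ∧ y = P j s ∧ ∃ j' < n, j' + 1 = j + 2 * s ∧ z = w j') ?_ ?_ ?_ ?_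
  · intro z
    constructor
    · rintro ⟨⟨h1, h2, -⟩ | ⟨j', hj', rfl, h1⟩, e⟩
      · exact ⟨z, ⟨h2, e⟩, Or.inl ⟨h.not_mem_top_low h1, rfl⟩⟩
      · obtain ⟨s, hs, e'⟩ := h.exists_side_of_adj hj hj' e
        rcases h.gap_of_new hj hj' e' hs (Or.inl hw) h1 with ⟨-, h2⟩ | hg
        · exact ⟨w j', ⟨h2, e⟩, Or.inl ⟨h.not_mem_top_w hj', rfl⟩⟩
        · exact ⟨P j s, ((h.port_w j hj hw _).2 ⟨s, hs, hg, rfl⟩).1,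
            Or.inr ⟨s, hs, hg, rfl, j', hj', e', rfl⟩⟩
    · rintro ⟨y, hy, ⟨hyt, rfl⟩ | ⟨s, hs, hg, rfl, j', hj', e, rfl⟩⟩
      · exact ⟨h.mem_newSet_of_nbr (h.not_mem_top_w hj) hw hy.1 hyt hy.2, hy.2⟩
      · refine ⟨(h.mem_newSet_w hj').2 (Or.inr ?_), h.adj_w hj hj' e hs⟩
        obtain ⟨j₁, -, e₁, hg₁⟩ := h.exists_next hj hs hg
        obtain rfl : j₁ = j' := by omega
        exact hg₁
  · intro y hy
    by_cases hyt : y ∈ top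
    · obtain ⟨s, hs, hg, rfl⟩ := (h.port_w j hj hw y).1 ⟨hy, hyt⟩
      obtain ⟨j', hj', e, -⟩ := h.exists_next hj hs hg
      exact ⟨w j', Or.inr ⟨s, hs, hg, rfl, j', hj', e, rfl⟩⟩
    · exact ⟨y, Or.inl ⟨hyt, rfl⟩⟩
  · rintro y z z' (⟨h1, rfl⟩ | ⟨s, hs, hg, rfl, j', hj', e, rfl⟩)
      (⟨h2, rfl⟩ | ⟨s', hs', hg', e2, j'', hj'', e', rfl⟩)
    · rfl
    · exact (h1 (e2 ▸ h.port_mem j hj s' hs')).elim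
    · exact (h2 (h.port_mem j hj s hs)).elim
    · obtain rfl := (h.port_inj j hj s hs j hj s' hs' e2).2
      obtain rfl : j' = j'' := by omega
      rfl
  · rintro y hy y' hy' z (⟨h1, rfl⟩ | ⟨s, hs, hg, rfl, j', hj', e, rfl⟩)
      (⟨h2, e2⟩ | ⟨s', hs', hg', rfl, j'', hj'', e', e2⟩)
    · exact e2
    · exact (h.no_gap' hj hj'' e' hs' hw (e2 ▸ hy.1) hg').elim
    · exact (h.no_gap' hj hj' e hs hw (e2 ▸ hy'.1) hg).elim
    · obtain rfl := h.w_inj j' hj' j'' hj'' e2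
      obtain rfl : s = s' := by omega
      rfl

theorem mem_nbrsIn_inserted {j : ℕ} (hj : j < n) (hw : w j ∉ S) (hN : g j ∨ g (j + 1)) (z : V) :
    z ∈ G.nbrsIn (newSet G S a b low n w g) (w j) ↔
      (∃ s ≤ 1, g (j + s) ∧ ∃ j' < n, j' + 1 = j + 2 * s ∧ z = w j') ∨
      (z ∈ low ∧ z ∈ newSet G S a b low n w g ∧ G.Adj (w j) z) := by
  constructor
  · rintro ⟨hz, e⟩
    rcases hz with h0 | ⟨j', hj', rfl, h1⟩
    · exact Or.inr ⟨h0.1, Or.inl h0, e⟩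
    · obtain ⟨s, hs, e'⟩ := h.exists_side_of_adj hj hj' e
      rcases h.gap_of_new hj hj' e' hs (Or.inr hN) h1 with ⟨h2, -⟩ | hg
      · exact (hw h2).elim
      · exact Or.inl ⟨s, hs, hg, j', hj', e', rfl⟩
  · rintro (⟨s, hs, hg, j', hj', e, rfl⟩ | ⟨-, h1, h2⟩)
    · refine ⟨(h.mem_newSet_w hj').2 (Or.inr ?_), h.adj_w hj hj' e hs⟩
      obtain ⟨j₁, -, e₁, hg₁⟩ := h.exists_next hj hs hg
      obtain rfl : j₁ = j' := by omega
      exact hg₁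
    · exact ⟨h1, h2⟩

open scoped Classical in
theorem newCol_w {j : ℕ} (hj : j < n) : newCol G S c low n w g γ P (w j) =
    if w j ∈ S then c (w j) else if g j then γ j else γ (j + 1) := by
  rw [newCol, if_pos ⟨j, hj, rfl⟩]
  refine if_congr Iff.rfl rfl ?_
  obtain ⟨j', hj', e, e'⟩ := Classical.epsilon_spec
    (p := fun k => ∃ j' < n, w j = w j' ∧ k = if g j' then γ j' else γ (j' + 1))
    ⟨_, j, hj, rfl, rfl⟩
  obtain rfl := h.w_inj j hj j' hj' e
  exact e'

theorem newCol_low {u : V} (hu : u ∈ low) (hd : ∀ j, ¬ Dbl G S low n w g j u) :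
    newCol G S c low n w g γ P u = c u := by
  rw [newCol, if_neg, if_neg]
  · rintro ⟨j, hj⟩
    exact hd j hj
  · rintro ⟨j, hj, rfl⟩
    exact h.w_not_low j hj hu

theorem newCol_dbl {j : ℕ} {u t : V} (hd : Dbl G S low n w g j u) (hb : u = a ∨ u = b)
    (ht : t ∈ G.nbrsIn S u) (t0 : t ≠ P j 0) (t1 : t ≠ P j 1) :
    newCol G S c low n w g γ P u = c t := by
  rw [newCol, if_neg, if_pos ⟨j, hd⟩]
  · obtain ⟨j', hd', t', ht', t0', t1', e'⟩ := Classical.epsilon_spec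
      (p := fun k => ∃ j, Dbl G S low n w g j u ∧
        ∃ t ∈ G.nbrsIn S u, t ≠ P j 0 ∧ t ≠ P j 1 ∧ k = c t) ⟨_, j, hd, t, ht, t0, t1, rfl⟩
    obtain rfl := h.dbl_unique hd hd' hb
    rw [e', h.eq_of_dbl hd hb ht ht' t0 t1 t0' t1']
  · rintro ⟨j', hj', rfl⟩
    exact h.w_not_low j' hj' hd.2.2.1

/-- The new color of a vertex before `w` is the color of a neighbor of it in the old frame. -/
theorem newCol_eq_of_nbr {u y : V} (hu : u ∈ low) (huS : u ∈ newSet G S a b low n w g)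
    (hy : y ∈ G.nbrsIn S u) (hyb : ¬ (y = a ∨ y = b))
    (hP : ∀ j, Dbl G S low n w g j u → y ≠ P j 0 ∧ y ≠ P j 1)
    (hub : (∀ j, ¬ Dbl G S low n w g j u) → ¬ (u = a ∨ u = b)) :
    newCol G S c low n w g γ P u = c y := by
  obtain ⟨h1, h2⟩ := (h.mem_newSet_low hu).1 huS
  by_cases hd : ∃ j, Dbl G S low n w g j u
  · obtain ⟨j, hd⟩ := hd
    exact h.newCol_dbl hd (h2 ⟨j, hd⟩) hy (hP j hd).1 (hP j hd).2
  · push Not at hd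
    rw [h.newCol_low hu hd]
    exact h.frame.col_eq h1 hy.1 (hub hd) hyb hy.2

section NewBranch

variable {a' b' : V} (ha : NewBranch G S low n w g a a') (hb : NewBranch G S low n w g b b')
include ha hb

omit h in
theorem newBranch_iff_of_not_dbl {x : V} (hx : x ∈ S) (hd : ∀ j, ¬ Dbl G S low n w g j x) :
    (x = a' ∨ x = b') ↔ (x = a ∨ x = b) := by
  have key : ∀ u u', NewBranch G S low n w g u u' → (x = u' ↔ x = u) := by
    rintro u u' (⟨-, rfl⟩ | ⟨j, hj, rfl⟩)
    · rfl
    · constructor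
      · rintro rfl
        exact (hj.2.1 hx).elim
      · rintro rfl
        exact (hd j hj).elim
  rw [key a a' ha, key b b' hb]

theorem newBranch_iff_of_not_mem {j : ℕ} (hj : j < n) (hw : w j ∉ S) :
    (w j = a' ∨ w j = b') ↔ ∃ u, (u = a ∨ u = b) ∧ Dbl G S low n w g j u := by
  have key : ∀ u u', u ∈ S → (u = a ∨ u = b) → NewBranch G S low n w g u u' →
      (w j = u' ↔ Dbl G S low n w g j u) := by
    rintro u u' hu hub (⟨h1, rfl⟩ | ⟨j', hj', rfl⟩)
    · constructor
      · rintro rfl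
        exact (hw hu).elim
      · intro h2
        exact (h1 j h2).elim
    · constructor
      · intro e
        rwa [h.w_inj j hj j' hj'.1 e]
      · intro h2
        rw [h.dbl_unique h2 hj' hub]
  rw [key a a' h.frame.left_mem (Or.inl rfl) ha, key b b' h.frame.right_mem (Or.inr rfl) hb]
  constructor
  · rintro (h1 | h1)
    exacts [⟨a, Or.inl rfl, h1⟩, ⟨b, Or.inr rfl, h1⟩]
  · rintro ⟨u, rfl | rfl, h1⟩
    exacts [Or.inl h1, Or.inr h1]

omit ha hb in
theorem newBranch_mem {u u' : V} (hu : u = a ∨ u = b) (hn : NewBranch G S low n w g u u') :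
    u' ∈ newSet G S a b low n w g := by
  have huS : u ∈ S := by
    rcases hu with rfl | rfl
    exacts [h.frame.left_mem, h.frame.right_mem]
  rcases hn with ⟨h1, rfl⟩ | ⟨j, hj, rfl⟩
  · rcases h.sub u' huS with h2 | ⟨j, hj, rfl⟩ | h2
    · exact (h.mem_newSet_low h2).2 ⟨huS, fun _ => hu⟩
    · exact (h.mem_newSet_w hj).2 (Or.inl huS)
    · exact (h.top_not_branch u' huS h2 hu).elim
  · exact (h.mem_newSet_w hj.1).2 (Or.inr (Or.inl hj.2.2.2.2.2.1))

omit ha hb in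
-- If `u` is in `low`, then `w j` would have two ancestors. If `u` is in the layer of `w`, it has an
-- ancestor as a branch vertex, and so does its neighbor `w j`.
theorem not_adj_of_dbl {u v : V} {j : ℕ} (hu : u = a ∨ u = b) (hv : v = a ∨ v = b) (huv : u ≠ v)
    (hd : Dbl G S low n w g j v) : ¬ G.Adj u (w j) := by
  intro e
  obtain ⟨hj, hw, hvl, hvS, ev, -, -⟩ := hd
  have huS : u ∈ S := by
    rcases hu with rfl | rfl
    exacts [h.frame.left_mem, h.frame.right_mem]
  rcases h.sub u huS with h2 | ⟨j', hj', rfl⟩ | h2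
  · exact huv (h.low_unique j hj u h2 v hvl e.symm ev)
  · obtain ⟨t, ht, -, et⟩ := h.exists_low_nbr_of_branch hj' hu
    obtain ⟨s, hs, e'⟩ := h.exists_side_of_adj hj' hj e
    exact h.low_sep' hj' hj e' hs ht hvl et ev
  · exact h.top_not_branch u huS h2 hu

theorem newBranch_ne : a' ≠ b' := by
  rcases ha with ⟨h1, rfl⟩ | ⟨j, hj, rfl⟩ <;> rcases hb with ⟨h1', rfl⟩ | ⟨j', hj', rfl⟩
  · exact h.frame.ne
  · intro e
    exact hj'.2.1 (e ▸ h.frame.left_mem)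
  · intro e
    exact hj.2.1 (e ▸ h.frame.right_mem)
  · intro e
    obtain rfl := h.w_inj j hj.1 j' hj'.1 e
    exact h.frame.ne (h.low_unique j hj.1 a hj.2.2.1 b hj'.2.2.1 hj.2.2.2.2.1 hj'.2.2.2.2.1)

theorem newBranch_not_adj : ¬ G.Adj a' b' := by
  rcases ha with ⟨h1, rfl⟩ | ⟨j, hj, rfl⟩ <;> rcases hb with ⟨h1', rfl⟩ | ⟨j', hj', rfl⟩
  · exact h.frame.not_adj
  · exact h.not_adj_of_dbl (Or.inl rfl) (Or.inr rfl) h.frame.ne hj'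
  · exact fun e => h.not_adj_of_dbl (Or.inr rfl) (Or.inl rfl) h.frame.ne.symm hj e.symm
  · intro e
    obtain ⟨s, hs, e'⟩ := h.exists_side_of_adj hj.1 hj'.1 e
    exact h.low_sep' hj.1 hj'.1 e' hs hj.2.2.1 hj'.2.2.1 hj.2.2.2.2.1 hj'.2.2.2.2.1

theorem newCol_of_gap {j s : ℕ} (hj : j < n) (hs : s ≤ 1) (hg : g (j + s))
    (hx : ¬ (w j = a' ∨ w j = b')) : newCol G S c low n w g γ P (w j) = γ (j + s) := by
  classical
  rw [h.newCol_w hj]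
  by_cases hw : w j ∈ S
  · rw [if_pos hw, ← h.port_col j hj s hs hg]
    have hp := ((h.port_w j hj hw _).2 ⟨s, hs, hg, rfl⟩).1
    rw [newBranch_iff_of_not_dbl ha hb hw
      (fun j' hd => h.w_not_low j hj hd.2.2.1)] at hx
    exact h.frame.col_eq hw hp.1 hx (h.top_not_branch _ hp.1 (h.port_mem j hj s hs)) hp.2
  · rw [if_neg hw]
    -- Both gaps at an inserted vertex carry the same color: the frame links them through a doubly
    -- met ordinary vertex `v`, or by crossing the box.
    have key : g j → g (j + 1) → γ j = γ (j + 1) := by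
      intro g0 g1
      by_cases hv : ∃ v ∈ low, v ∈ S ∧ G.Adj (w j) v
      · obtain ⟨v, hvl, hvS, ev⟩ := hv
        have hd : Dbl G S low n w g j v := ⟨hj, hw, hvl, hvS, ev, g0, g1⟩
        have hvb : ¬ (v = a ∨ v = b) := fun hvb =>
          hx ((h.newBranch_iff_of_not_mem ha hb hj hw).2 ⟨v, hvb, hd⟩)
        have p0 := h.port_nbr hd (s := 0) (by omega)
        have p1 := h.port_nbr hd (s := 1) le_rfl
        have e0 := h.frame.col_eq hvS p0.1 hvb
          (h.top_not_branch _ p0.1 (h.port_mem j hj 0 (by omega))) p0.2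
        have e1 := h.frame.col_eq hvS p1.1 hvb
          (h.top_not_branch _ p1.1 (h.port_mem j hj 1 le_rfl)) p1.2
        rw [← h.port_col j hj 1 le_rfl g1, ← e1, e0]
        exact (h.port_col j hj 0 (by omega) g0).symm
      · push Not at hv
        exact (h.through j hj hw hv).2 g0
    rcases Nat.le_one_iff_eq_zero_or_eq_one.1 hs with rfl | rfl
    · exact if_pos hg
    · by_cases g0 : g j
      · rw [if_pos g0, key g0 hg]
      · rw [if_neg g0]

omit ha hb in
theorem w_not_dbl {j : ℕ} (hj : j < n) (j' : ℕ) : ¬ Dbl G S low n w g j' (w j) :=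
  fun hd => h.w_not_low j hj hd.2.2.1

theorem newCol_adj_w_w {j j' : ℕ} (hj : j < n) (hj' : j' < n)
    (hN : w j ∈ newSet G S a b low n w g) (hN' : w j' ∈ newSet G S a b low n w g)
    (hx : ¬ (w j = a' ∨ w j = b')) (hx' : ¬ (w j' = a' ∨ w j' = b')) (e : G.Adj (w j) (w j')) :
    newCol G S c low n w g γ P (w j') = newCol G S c low n w g γ P (w j) := by
  classical
  obtain ⟨s, hs, e'⟩ := h.exists_side_of_adj hj hj' e
  rcases h.gap_of_new hj hj' e' hs ((h.mem_newSet_w hj).1 hN) ((h.mem_newSet_w hj').1 hN') with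
    ⟨h1, h2⟩ | hg
  · rw [newBranch_iff_of_not_dbl ha hb h1 (h.w_not_dbl hj)] at hx
    rw [newBranch_iff_of_not_dbl ha hb h2 (h.w_not_dbl hj')] at hx'
    rw [h.newCol_w hj, h.newCol_w hj', if_pos h1, if_pos h2]
    exact h.frame.col_eq h2 h1 hx' hx e.symm
  · rw [h.newCol_of_gap ha hb hj hs hg hx]
    have e1 : j + s = j' + (1 - s) := by omega
    rw [e1] at hg ⊢
    exact h.newCol_of_gap ha hb hj' (by omega) hg hx'

theorem newCol_adj_low_w {u : V} {j : ℕ} (hj : j < n) (hu : u ∈ low)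
    (hN : w j ∈ newSet G S a b low n w g) (hN' : u ∈ newSet G S a b low n w g)
    (hx : ¬ (w j = a' ∨ w j = b')) (hx' : ¬ (u = a' ∨ u = b')) (e : G.Adj (w j) u) :
    newCol G S c low n w g γ P u = newCol G S c low n w g γ P (w j) := by
  classical
  obtain ⟨huS, -⟩ := (h.mem_newSet_low hu).1 hN'
  have hub : (∀ j, ¬ Dbl G S low n w g j u) → ¬ (u = a ∨ u = b) := fun hd => by
    rwa [← newBranch_iff_of_not_dbl ha hb huS hd]
  have hN1 := (h.mem_newSet_w hj).1 hN
  by_cases hw : w j ∈ S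
  · rw [newBranch_iff_of_not_dbl ha hb hw (h.w_not_dbl hj)] at hx
    rw [h.newCol_w hj, if_pos hw]
    refine h.newCol_eq_of_nbr hu hN' ⟨hw, e.symm⟩ hx (fun j' hd => ?_) hub
    exact ⟨fun e => h.not_mem_top_w hj (e ▸ h.port_mem j' hd.1 0 (by omega)),
      fun e => h.not_mem_top_w hj (e ▸ h.port_mem j' hd.1 1 le_rfl)⟩
  · have hnd : ¬ Dbl G S low n w g j u := fun hd =>
      hx ((h.newBranch_iff_of_not_mem ha hb hj hw).2
        ⟨u, ((h.mem_newSet_low hu).1 hN').2 ⟨j, hd⟩, hd⟩)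
    obtain ⟨s, hs, hg⟩ : ∃ s ≤ 1, g (j + s) := by
      rcases hN1.resolve_left hw with h2 | h2
      exacts [⟨0, by omega, h2⟩, ⟨1, le_rfl, h2⟩]
    rw [h.newCol_of_gap ha hb hj hs hg hx, ← h.port_col j hj s hs hg]
    have hp := ((h.port_low u huS hu _).2 ⟨j, hj, hw, e, s, hs, hg, rfl⟩).1
    refine h.newCol_eq_of_nbr hu hN' hp (h.top_not_branch _ hp.1 (h.port_mem j hj s hs))
      (fun j' hd => ?_) hub
    have hne : ∀ s' ≤ 1, P j s ≠ P j' s' := by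
      intro s' hs' e2
      obtain rfl := (h.port_inj j hj s hs j' hd.1 s' hs' e2).1
      exact hnd hd
    exact ⟨hne 0 (by omega), hne 1 le_rfl⟩

/-- Kept doubly met vertices are old branch vertices, hence not adjacent. So one end keeps its
color, and the other agrees with it by `newCol_eq_of_nbr`. -/
theorem newCol_adj_low_low {u v : V} (hu : u ∈ low) (hv : v ∈ low)
    (hN : u ∈ newSet G S a b low n w g) (hN' : v ∈ newSet G S a b low n w g)
    (hx : ¬ (u = a' ∨ u = b')) (hx' : ¬ (v = a' ∨ v = b')) (e : G.Adj u v) :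
    newCol G S c low n w g γ P v = newCol G S c low n w g γ P u := by
  have aux : ∀ u ∈ low, ∀ v ∈ low, u ∈ newSet G S a b low n w g → v ∈ newSet G S a b low n w g →
      ¬ (u = a' ∨ u = b') → ¬ (v = a' ∨ v = b') → G.Adj u v →
      (∀ j, ¬ Dbl G S low n w g j v) →
      newCol G S c low n w g γ P v = newCol G S c low n w g γ P u := by
    intro u hu v hv hN hN' hx hx' e hd
    obtain ⟨huS, -⟩ := (h.mem_newSet_low hu).1 hN
    obtain ⟨hvS, -⟩ := (h.mem_newSet_low hv).1 hN'
    rw [newBranch_iff_of_not_dbl ha hb hvS hd] at hx'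
    rw [h.newCol_low hv hd]
    refine (h.newCol_eq_of_nbr hu hN ⟨hvS, e⟩ hx' (fun j' hd => ?_) fun hd => ?_).symm
    · exact ⟨fun e => h.not_mem_top_low hv (e ▸ h.port_mem j' hd.1 0 (by omega)),
        fun e => h.not_mem_top_low hv (e ▸ h.port_mem j' hd.1 1 le_rfl)⟩
    · rwa [← newBranch_iff_of_not_dbl ha hb huS hd]
  by_cases hd : ∃ j, Dbl G S low n w g j v
  · by_cases hd' : ∃ j, Dbl G S low n w g j u
    · exact (h.frame.not_adj_of_branch (((h.mem_newSet_low hu).1 hN).2 hd')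
        (((h.mem_newSet_low hv).1 hN').2 hd) e).elim
    · push Not at hd'
      exact (aux v hv u hu hN' hN hx' hx e.symm hd').symm
  · push Not at hd
    exact aux u hu v hv hN hN' hx hx' e hd

theorem newCol_adj {u v : V} (hN : u ∈ newSet G S a b low n w g)
    (hN' : v ∈ newSet G S a b low n w g) (hx : ¬ (u = a' ∨ u = b')) (hx' : ¬ (v = a' ∨ v = b'))
    (e : G.Adj u v) : newCol G S c low n w g γ P v = newCol G S c low n w g γ P u := by
  have hN1 := hN
  have hN1' := hN'
  rcases hN with ⟨hu, -⟩ | ⟨j, hj, rfl, -⟩ <;> rcases hN' with ⟨hv, -⟩ | ⟨j', hj', rfl, -⟩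
  · exact h.newCol_adj_low_low ha hb hu hv hN1 hN1' hx hx' e
  · exact (h.newCol_adj_low_w ha hb hj' hu hN1' hN1 hx' hx e.symm).symm
  · exact h.newCol_adj_low_w ha hb hj hv hN1 hN1' hx hx' e
  · exact h.newCol_adj_w_w ha hb hj hj' hN1 hN1' hx hx' e

/-- An inserted vertex that is not a branch vertex has two neighbors in the new frame. -/
theorem encard_inserted {j : ℕ} (hj : j < n) (hw : w j ∉ S) (hN : g j ∨ g (j + 1))
    (hx : ¬ (w j = a' ∨ w j = b')) :
    (G.nbrsIn (newSet G S a b low n w g) (w j)).encard = 2 := by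
  by_cases hboth : g j ∧ g (j + 1)
  · obtain ⟨g0, g1⟩ := hboth
    obtain ⟨j₀, h0, e0, -⟩ := h.exists_next (s := 0) hj (by omega) g0
    obtain ⟨j₁, h1, e1, -⟩ := h.exists_next (s := 1) hj le_rfl g1
    have : G.nbrsIn (newSet G S a b low n w g) (w j) = {w j₀, w j₁} := by
      ext z
      rw [h.mem_nbrsIn_inserted hj hw hN]
      constructor
      · rintro (⟨s, hs, -, j', hj', e, rfl⟩ | ⟨hl, hz, e⟩)
        · rcases Nat.le_one_iff_eq_zero_or_eq_one.1 hs with rfl | rfl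
          · obtain rfl : j' = j₀ := by omega
            exact Or.inl rfl
          · obtain rfl : j' = j₁ := by omega
            exact Or.inr rfl
        · obtain ⟨hzS, hzb⟩ := (h.mem_newSet_low hl).1 hz
          have hd : Dbl G S low n w g j z := ⟨hj, hw, hl, hzS, e, g0, g1⟩
          exact (hx ((h.newBranch_iff_of_not_mem ha hb hj hw).2 ⟨z, hzb ⟨j, hd⟩, hd⟩)).elim
      · rintro (rfl | rfl)
        exacts [Or.inl ⟨0, by omega, g0, j₀, h0, e0, rfl⟩,
          Or.inl ⟨1, le_rfl, g1, j₁, h1, e1, rfl⟩]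
    rw [this, Set.encard_pair]
    intro e
    have := h.w_inj _ h0 _ h1 e
    omega
  · obtain ⟨v, hv, hvS, ev⟩ := h.exists_low_nbr hj hw hN hboth
    obtain ⟨s, hs, hg⟩ : ∃ s ≤ 1, g (j + s) := by
      rcases hN with h2 | h2
      exacts [⟨0, by omega, h2⟩, ⟨1, le_rfl, h2⟩]
    obtain ⟨j', hj', e', -⟩ := h.exists_next hj hs hg
    -- If `v` were dropped, its only neighbors would be the two ports of one box; as `P j s` is
    -- among them, that box is the one of `w j`, which has only one used gap.
    have hvN : v ∈ newSet G S a b low n w g := by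
      refine (h.mem_newSet_low hv).2 ⟨hvS, ?_⟩
      rintro ⟨j₁, hd⟩
      by_contra hvb
      have hp := ((h.port_low v hvS hv _).2 ⟨j, hj, hw, ev, s, hs, hg, rfl⟩).1
      have hne : j₁ = j := by
        rcases h.frame.eq_or_eq hvS hvb (h.port_nbr hd (s := 0) (by omega))
          (h.port_nbr hd le_rfl) (h.ports_ne hd.1) hp with e | e
        · exact (h.port_inj j hj s hs j₁ hd.1 0 (by omega) e).1.symm
        · exact (h.port_inj j hj s hs j₁ hd.1 1 le_rfl e).1.symm
      subst hne
      exact hboth hd.2.2.2.2.2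
    have : G.nbrsIn (newSet G S a b low n w g) (w j) = {w j', v} := by
      ext z
      rw [h.mem_nbrsIn_inserted hj hw hN]
      constructor
      · rintro (⟨s', hs', hg', j₁, hj₁, e, rfl⟩ | ⟨hl, hz, e⟩)
        · have : s = s' := by
            rcases Nat.le_one_iff_eq_zero_or_eq_one.1 hs with rfl | rfl <;>
              rcases Nat.le_one_iff_eq_zero_or_eq_one.1 hs' with rfl | rfl
            exacts [rfl, (hboth ⟨hg, hg'⟩).elim, (hboth ⟨hg', hg⟩).elim, rfl]
          subst this
          obtain rfl : j₁ = j' := by omega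
          exact Or.inl rfl
        · exact Or.inr (h.low_unique j hj z hl v hv e ev)
      · rintro (rfl | rfl)
        exacts [Or.inl ⟨s, hs, hg, j', hj', e', rfl⟩, Or.inr ⟨hv, hvN, ev⟩]
    rw [this, Set.encard_pair]
    rintro rfl
    exact h.w_not_low _ hj' hv

omit ha hb in
-- The two ports merge into `w j` and the third neighbor keeps its own image, so the former branch
-- vertex drops to degree two.
theorem encard_dbl {j : ℕ} {u : V} (hd : Dbl G S low n w g j u) (hub : u = a ∨ u = b) :
    (G.nbrsIn (newSet G S a b low n w g) u).encard = 2 := by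
  have hd' := hd
  obtain ⟨hj, hw, hu, huS, e, g0, g1⟩ := hd
  obtain ⟨z, hz, z0, z1⟩ := h.frame.exists_ne_ne hub (P j 0) (P j 1)
  obtain ⟨z', hz'⟩ := h.exists_image_low hu huS hz
  have himg : ∀ s ≤ 1, (P j s ∉ top ∧ w j = P j s) ∨ ∃ j' < n, w j' ∉ S ∧ G.Adj (w j') u ∧
      ∃ s' ≤ 1, g (j' + s') ∧ P j s = P j' s' ∧ w j = w j' := by
    intro s hs
    refine Or.inr ⟨j, hj, hw, e, s, hs, ?_, rfl, rfl⟩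
    rcases Nat.le_one_iff_eq_zero_or_eq_one.1 hs with rfl | rfl
    exacts [g0, g1]
  have : G.nbrsIn (newSet G S a b low n w g) u = {w j, z'} := by
    ext t
    rw [h.mem_nbrsIn_low hu huS]
    constructor
    · rintro ⟨y, hy, hyt⟩
      by_cases y0 : y = P j 0
      · subst y0
        exact Or.inl (h.image_low_unique hyt (himg 0 (by omega)))
      by_cases y1 : y = P j 1
      · subst y1
        exact Or.inl (h.image_low_unique hyt (himg 1 le_rfl))
      obtain rfl := h.eq_of_dbl hd' hub hz hy z0 z1 y0 y1
      exact Or.inr (h.image_low_unique hyt hz')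
    · rintro (rfl | rfl)
      exacts [⟨P j 0, h.port_nbr hd' (by omega), himg 0 (by omega)⟩, ⟨z, hz, hz'⟩]
  rw [this, Set.encard_pair]
  rintro rfl
  rcases hz' with ⟨-, rfl⟩ | ⟨j', hj', -, -, s, hs, -, rfl, e'⟩
  · exact hw hz.1
  · obtain rfl := h.w_inj j hj j' hj' e'
    rcases Nat.le_one_iff_eq_zero_or_eq_one.1 hs with rfl | rfl
    exacts [z0 rfl, z1 rfl]

theorem encard_new {x : V} (hx : x ∈ newSet G S a b low n w g) (hxb : ¬ (x = a' ∨ x = b')) :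
    (G.nbrsIn (newSet G S a b low n w g) x).encard = 2 := by
  rcases hx with ⟨hl, hS, hd⟩ | ⟨j, hj, rfl, hN⟩
  · by_cases hdb : ∃ j, Dbl G S low n w g j x
    · obtain ⟨j, hj⟩ := hdb
      exact h.encard_dbl hj (hd ⟨j, hj⟩)
    · push Not at hdb
      rw [newBranch_iff_of_not_dbl ha hb hS hdb] at hxb
      push Not at hxb
      obtain ⟨f, hf, -⟩ := h.exists_bijOn_low hl hS hdb
      rw [encard_eq hf]
      exact h.frame.deg x hS hxb.1 hxb.2
  · by_cases hw : w j ∈ S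
    · rw [newBranch_iff_of_not_dbl ha hb hw (h.w_not_dbl hj)] at hxb
      push Not at hxb
      obtain ⟨f, hf, -⟩ := h.exists_bijOn_w hj hw
      rw [encard_eq hf]
      exact h.frame.deg _ hw hxb.1 hxb.2
    · exact h.encard_inserted ha hb hj hw (hN.resolve_left hw) hxb

omit ha hb in
theorem newCol_kept {y : V} (hy : y ∈ S) (hyt : y ∉ top) (hyN : y ∈ newSet G S a b low n w g)
    (hyb : ¬ (y = a ∨ y = b)) : newCol G S c low n w g γ P y = c y := by
  classical
  rcases hyN with ⟨hl, -, hd⟩ | ⟨j, hj, rfl, -⟩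
  · exact h.newCol_low hl fun j hj => hyb (hd ⟨j, hj⟩)
  · rw [h.newCol_w hj, if_pos hy]

theorem bijOn_new {u u' : V} (hu : u = a ∨ u = b) (hu' : u' = a' ∨ u' = b')
    (hn : NewBranch G S low n w g u u') :
    Set.BijOn (newCol G S c low n w g γ P) (G.nbrsIn (newSet G S a b low n w g) u') Set.univ := by
  have huS : u ∈ S := by
    rcases hu with rfl | rfl
    exacts [h.frame.left_mem, h.frame.right_mem]
  have hnadj : ∀ z, G.Adj u' z → ¬ (z = a' ∨ z = b') := by
    rintro z e (rfl | rfl) <;> rcases hu' with rfl | rfl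
    exacts [G.loopless.irrefl _ e, h.newBranch_not_adj ha hb e.symm, h.newBranch_not_adj ha hb e,
      G.loopless.irrefl _ e]
  rcases hn with ⟨hd, rfl⟩ | ⟨j, hd, rfl⟩
  · rcases h.sub u' huS with hl | ⟨j, hj, rfl⟩ | ht
    · obtain ⟨f, hf, hR⟩ := h.exists_bijOn_low hl huS hd
      refine bijOn_col hf (h.frame.bij hu) fun y hy => ?_
      have hfy := hf.mapsTo hy
      rcases hR y hy with ⟨h1, h2⟩ | ⟨j, hj, hw, e, s, hs, hg, rfl, h2⟩
      · rw [h2] at hfy ⊢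
        exact h.newCol_kept hy.1 h1 hfy.1 (h.frame.not_branch_of_adj hu hy.2)
      · rw [h2] at hfy ⊢
        rw [h.newCol_of_gap ha hb hj hs hg (hnadj _ hfy.2), h.port_col j hj s hs hg]
    · obtain ⟨f, hf, hR⟩ := h.exists_bijOn_w hj huS
      refine bijOn_col hf (h.frame.bij hu) fun y hy => ?_
      have hfy := hf.mapsTo hy
      rcases hR y hy with ⟨h1, h2⟩ | ⟨s, hs, hg, rfl, j', hj', e, h2⟩
      · rw [h2] at hfy ⊢
        exact h.newCol_kept hy.1 h1 hfy.1 (h.frame.not_branch_of_adj hu hy.2)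
      · rw [h2] at hfy ⊢
        have e1 : j + s = j' + (1 - s) := by omega
        rw [h.port_col j hj s hs hg, e1]
        exact h.newCol_of_gap ha hb hj' (by omega) (e1 ▸ hg) (hnadj _ hfy.2)
    · exact (h.top_not_branch u' huS ht hu).elim
  -- The branch moved from `u` to `w j`. The ports correspond to the two layer neighbors of `w j`,
  -- and the third neighbor of `u` corresponds to `u` itself, whose new color was defined as the
  -- color of that neighbor.
  · have hd' := hd
    obtain ⟨hj, hw, hl, -, e, g0, g1⟩ := hd
    obtain ⟨j₀, h0, e0, -⟩ := h.exists_next (s := 0) hj (by omega) g0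
    obtain ⟨j₁, h1, e1, -⟩ := h.exists_next (s := 1) hj le_rfl g1
    have huN : u ∈ newSet G S a b low n w g := (h.mem_newSet_low hl).2 ⟨huS, fun _ => hu⟩
    have p0 := h.port_nbr hd' (s := 0) (by omega)
    have p1 := h.port_nbr hd' (s := 1) le_rfl
    have pne := h.ports_ne hj
    obtain ⟨z, hz, z0, z1⟩ := h.frame.exists_ne_ne hu (P j 0) (P j 1)
    have hne : w j₀ ≠ w j₁ := fun e => by
      have := h.w_inj _ h0 _ h1 e
      omega
    have hu0 : w j₀ ≠ u := fun e => h.w_not_low _ h0 (e ▸ hl)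
    have hu1 : w j₁ ≠ u := fun e => h.w_not_low _ h1 (e ▸ hl)
    obtain ⟨f, hf, hR⟩ := exists_bijOn (A := G.nbrsIn S u)
      (B := G.nbrsIn (newSet G S a b low n w g) (w j))
      (R := fun y t => (y = P j 0 ∧ t = w j₀) ∨ (y = P j 1 ∧ t = w j₁) ∨
        (y ≠ P j 0 ∧ y ≠ P j 1 ∧ t = u)) (by
        intro t
        rw [h.mem_nbrsIn_inserted hj hw (Or.inl g0)]
        constructor
        · rintro (⟨s, hs, -, j', hj', e', rfl⟩ | ⟨hl', hz, e'⟩)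
          · rcases Nat.le_one_iff_eq_zero_or_eq_one.1 hs with rfl | rfl
            · obtain rfl : j' = j₀ := by omega
              exact ⟨_, p0, Or.inl ⟨rfl, rfl⟩⟩
            · obtain rfl : j' = j₁ := by omega
              exact ⟨_, p1, Or.inr (Or.inl ⟨rfl, rfl⟩)⟩
          · exact ⟨z, by assumption, Or.inr (Or.inr ⟨z0, z1, h.low_unique j hj t hl' u hl e' e⟩)⟩
        · rintro ⟨y, hy, ⟨-, rfl⟩ | ⟨-, rfl⟩ | ⟨-, -, rfl⟩⟩
          exacts [Or.inl ⟨0, by omega, g0, j₀, h0, e0, rfl⟩,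
            Or.inl ⟨1, le_rfl, g1, j₁, h1, e1, rfl⟩, Or.inr ⟨hl, huN, e⟩])
      (by
        intro y _
        by_cases y0 : y = P j 0
        · exact ⟨_, Or.inl ⟨y0, rfl⟩⟩
        by_cases y1 : y = P j 1
        · exact ⟨_, Or.inr (Or.inl ⟨y1, rfl⟩)⟩
        exact ⟨_, Or.inr (Or.inr ⟨y0, y1, rfl⟩)⟩)
      (by
        rintro y t t' (⟨r1, rfl⟩ | ⟨r1, rfl⟩ | ⟨r1, r2, rfl⟩)
          (⟨r1', rfl⟩ | ⟨r1', rfl⟩ | ⟨r1', r2', rfl⟩)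
        exacts [rfl, (pne (r1.symm.trans r1')).elim, (r1' r1).elim,
          (pne (r1'.symm.trans r1)).elim, rfl, (r2' r1).elim, (r1 r1').elim, (r2 r1').elim, rfl])
      (by
        rintro y hy y' hy' t (⟨rfl, rfl⟩ | ⟨rfl, rfl⟩ | ⟨r1, r2, rfl⟩)
          (⟨rfl, r⟩ | ⟨rfl, r⟩ | ⟨r1', r2', r⟩)
        exacts [rfl, (hne r).elim, (hu0 r).elim, (hne r.symm).elim, rfl, (hu1 r).elim,
          (hu0 r.symm).elim, (hu1 r.symm).elim, h.eq_of_dbl hd' hu hy' hy r1' r2' r1 r2])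
    refine bijOn_col hf (h.frame.bij hu) fun y hy => ?_
    have hfy := hf.mapsTo hy
    rcases hR y hy with ⟨rfl, h2⟩ | ⟨rfl, h2⟩ | ⟨y0, y1, h2⟩
    · rw [h2] at hfy ⊢
      have hg : g (j₀ + 1) := by rwa [show j₀ + 1 = j by omega]
      rw [h.port_col j hj 0 (by omega) g0, h.newCol_of_gap ha hb h0 le_rfl hg (hnadj _ hfy.2)]
      congr 1
    · rw [h2] at hfy ⊢
      have hg : g (j₁ + 0) := by rwa [show j₁ + 0 = j + 1 by omega]
      rw [h.port_col j hj 1 le_rfl g1, h.newCol_of_gap ha hb h1 (by omega) hg (hnadj _ hfy.2)]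
      congr 1
      omega
    · rw [h2]
      exact h.newCol_dbl hd' hu hy y0 y1

end NewBranch

/-- Pushing a frame down from the top layer. -/
theorem exists_thetaFrame (hfin : low.Finite) :
    ∃ S' ⊆ low ∪ w '' Set.Iio n, ∃ a' b' c', G.ThetaFrame S' a' b' c' := by
  obtain ⟨a', ha⟩ := exists_newBranch G S low n w g a
  obtain ⟨b', hb⟩ := exists_newBranch G S low n w g b
  have hsub : newSet G S a b low n w g ⊆ low ∪ w '' Set.Iio n := by
    rintro u (⟨hl, -⟩ | ⟨j, hj, rfl, -⟩)
    exacts [Or.inl hl, Or.inr ⟨j, hj, rfl⟩]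
  refine ⟨_, hsub, a', b', newCol G S c low n w g γ P,
    { fin := (hfin.union ((Set.finite_Iio n).image w)).subset hsub
      left_mem := h.newBranch_mem (Or.inl rfl) ha
      right_mem := h.newBranch_mem (Or.inr rfl) hb
      ne := h.newBranch_ne ha hb
      not_adj := h.newBranch_not_adj ha hb
      deg := fun x hx h1 h2 => h.encard_new ha hb hx (not_or.2 ⟨h1, h2⟩)
      col := fun x hx h1 h2 y hy h3 h4 =>
        h.newCol_adj ha hb hx hy.1 (not_or.2 ⟨h1, h2⟩) (not_or.2 ⟨h3, h4⟩) hy.2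
      bij_left := h.bijOn_new ha hb (Or.inl rfl) (Or.inl rfl) ha
      bij_right := h.bijOn_new ha hb (Or.inr rfl) (Or.inr rfl) hb }⟩

end GapFrame

/-! ### Induction on the layers and conclusion. -/

namespace IsTTFLayering

open LayerListing

variable {V : Type*} {G : SimpleGraph V} {l k : ℕ} {L : LayerListing V} {lo hi : ℕ → ℕ → ℕ}

theorem below_succ (i : ℕ) : L.below (i + 1) = L.below i ∪ L.vert i '' Set.Iio (L.len i) := by
  ext v
  constructor
  · rintro ⟨i', hi', hv⟩
    rcases Nat.lt_succ_iff_lt_or_eq.1 hi' with h1 | rfl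
    · exact Or.inl ⟨i', h1, hv⟩
    · obtain ⟨j, hj, rfl⟩ := hv
      exact Or.inr ⟨j, hj, rfl⟩
  · rintro (⟨i', hi', hv⟩ | ⟨j, hj, rfl⟩)
    exacts [⟨i', by omega, hv⟩, ⟨i, by omega, j, hj, rfl⟩]

theorem finite_below (L : LayerListing V) (i : ℕ) : (L.below i).Finite := by
  induction i with
  | zero =>
    convert Set.finite_empty
    ext v
    exact ⟨fun ⟨_, h, _⟩ => absurd h (Nat.not_lt_zero _), False.elim⟩
  | succ i ih =>
    rw [below_succ]
    exact ih.union ((Set.finite_Iio _).image _)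

theorem below_eq_univ (h : IsTTFLayering G l k L lo hi) : L.below (l + 1) = Set.univ := by
  refine Set.eq_univ_of_forall fun v => ?_
  obtain ⟨i, hi, hv⟩ := h.cover v
  exact ⟨i, by omega, hv⟩

/-- Excluding all frames, not only tight ones, makes the induction close: the frame pushed down need
not be shown tight, since tightness is restored at the start of the next step. -/
theorem not_thetaFrame (h : IsTTFLayering G l k L lo hi) (hk : 4 ≤ k) {i : ℕ} (hil : i ≤ l) :
    ∀ S ⊆ L.below (i + 1), ∀ a b c, ¬ G.ThetaFrame S a b c := by
  induction i with
  | zero =>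
    intro S hS a b c hF
    have key : ∀ y ∈ S, y = L.vert 0 0 := by
      intro y hy
      obtain ⟨i', hi', j, hj, e⟩ := hS hy
      obtain rfl : i' = 0 := by omega
      rw [h.len_zero] at hj
      obtain rfl : j = 0 := by omega
      exact e
    exact hF.ne ((key a hF.left_mem).trans (key b hF.right_mem).symm)
  | succ i ih =>
    intro S hS a b c hF
    obtain ⟨S₁, hS₁, hF₁, ht⟩ := hF.exists_tight
    have hT : TopFrame G S₁ a b c (L.below i) (L.below (i + 1)) (L.len i) (L.len (i + 1))
        (L.vert i) (L.vert (i + 1)) (lo i) (hi i) :=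
      { box := h.boxStep hk (by omega)
        frame := hF₁
        tight := ht
        sub := fun u hu => by
          have := hS (hS₁ hu)
          rw [below_succ] at this
          exact this.imp id fun ⟨x, hx, e⟩ => ⟨x, hx, e.symm⟩ }
    obtain ⟨top, g, γ, P, hG⟩ := hT.exists_gapFrame
    obtain ⟨S', hS', a', b', c', hF'⟩ := hG.exists_thetaFrame (finite_below L i)
    exact ih (by omega) S' (by rwa [below_succ]) a' b' c' hF'

theorem thetaFree (h : IsTTFLayering G l k L lo hi) (hk : 4 ≤ k) : G.ThetaFree := by
  intro S hS
  have hfin : Finite V := Set.finite_univ_iff.1 (h.below_eq_univ ▸ finite_below L (l + 1))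
  obtain ⟨a, b, c, hF⟩ := hS.exists_thetaFrame
  obtain ⟨c', hF'⟩ := hF.map (SimpleGraph.Embedding.induce S)
  exact h.not_thetaFrame hk le_rfl _ (by rw [h.below_eq_univ]; exact Set.subset_univ _) _ _ _ hF'

end IsTTFLayering

/-- A graph of girth at least four has no triangle. -/
theorem SimpleGraph.cliqueFree_three_of_le_egirth {V : Type*} {G : SimpleGraph V}
    (h : 4 ≤ G.egirth) : G.CliqueFree 3 := by
  classical
  intro s hs
  obtain ⟨x, y, z, hxy, hxz, hyz, -⟩ := SimpleGraph.is3Clique_iff.1 hs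
  have hc : (Walk.cons hxy (.cons hyz (.cons hxz.symm .nil))).IsCycle := by
    simp [Walk.isCycle_def, Walk.isTrail_def, hxy.ne, hxz.ne, hyz.ne, hxy.ne.symm, hxz.ne.symm]
  have := SimpleGraph.le_egirth.1 h _ _ hc
  norm_num at this

theorem mainTheorem1 (l k : ℕ) (hk : 4 ≤ k) {V : Type*} (G : SimpleGraph V)
    (hG : IsTTFLayeredWheel G l k) :
    G.ThetaFree ∧ (k : ℕ∞) ≤ G.egirth ∧ G.CliqueFree 3 := by
  obtain ⟨L, lo, hi, h⟩ := hG
  exact ⟨h.thetaFree hk, h.le_egirth,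
    SimpleGraph.cliqueFree_three_of_le_egirth (le_trans (by exact_mod_cast hk) h.le_egirth)⟩
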